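/- Let $n\ge 1$ and let $M$ be a non-empty smooth manifold of dimension $2n+1$ with an almost contact metric structure $(\varphi,\zeta,\eta,g)$: a smooth $(1,1)$-tensor field $\varphi$, a smooth vector field $\zeta$ (the Reeb field), a smooth 1-form $\eta$ and a smooth Riemannian metric $g$ such that $$\varphi^2+I=\eta\otimes\zeta,\qquad \eta(\zeta)=1,\qquad g(X,Y)=g(\varphi X,\varphi Y)+\eta(X)\eta(Y).$$ Suppose that the structure is almost co-Kähler, i.e. $d\eta=0$ and $d\Phi=0$, where $\Phi(X,Y)=g(X,\varphi Y)$. Let $K(X,Y)=[\nabla_X,\nabla_Y]-\nabla_{[X,Y]}$ be the Riemannian curvature tensor, $\mathrm{Ric}(Y,Z)=\mathrm{tr}(X\mapsto K(X,Y)Z)$ the Ricci tensor and $\tau$ the scalar curvature of $g$. Suppose that $\zeta$ belongs to the $\kappa$-nullity distribution for a real constant $\kappa<0$, i.e. $$K(X,Y)\zeta=\kappa\bigl(g(Y,\zeta)X-g(X,\zeta)Y\bigr)\qquad\text{for all vector fields } X,Y.$$ Then, for $m\ne 1$, $(M,g)$ admits no $(m,\rho)$-quasi-Einstein structure. That is,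 there are no $m\in(0,\infty]$ with $m\neq 1$, $\rho,\lambda_1\in\mathbb R$ and smooth function $\omega:M\to\mathbb R$ with $$\mathrm{Ric}+\mathrm{Hess}\,\omega-\frac1m\,d\omega\otimes d\omega=(\rho\tau+\lambda_1)\,g,$$ where $1/m=0$ for $m=\infty$. -/

import Mathlib

open scoped Manifold ContDiff Bundle ENNReal

noncomputable section

namespace AlmostCoKahler

section Charts

variable {d : ℕ} {M : Type*} [TopologicalSpace M] [ChartedSpace (EuclideanSpace ℝ (Fin d)) M]

/-- The smooth charts of the `d`-dimensional smooth manifold `M`: the elements of its maximal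
atlas. All tensor fields below are computed in such a chart `e`, at points `p ∈ e.source`. -/
def SmoothCharts (d : ℕ) (M : Type*) [TopologicalSpace M]
    [ChartedSpace (EuclideanSpace ℝ (Fin d)) M] :
    Set (OpenPartialHomeomorph M (EuclideanSpace ℝ (Fin d))) :=
  IsManifold.maximalAtlas (𝓡 d) ∞ M

/-- The coordinates `Xⁱ = dxⁱ(X)` of a tangent vector `X` at `p` in the chart `e`. -/
def coord (e : OpenPartialHomeomorph M (EuclideanSpace ℝ (Fin d))) (p : M)
    (X : TangentSpace (𝓡 d) p) (i : Fin d) : ℝ :=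
  mvfderiv (𝓡 d) e p X i

/-- The coordinate vector `∂ᵢ` at `p` of the chart `e`: the vector that the derivative of the
chart (invertible at points of its domain) sends to the `i`-th standard basis vector. -/
def frame (e : OpenPartialHomeomorph M (EuclideanSpace ℝ (Fin d))) (p : M) (i : Fin d) :
    TangentSpace (𝓡 d) p :=
  (mvfderiv (𝓡 d) e p).inverse (EuclideanSpace.single i (1 : ℝ))

/-- The partial derivative `∂f/∂xⁱ` at `p` in the coordinates of the chart `e`. -/
def partialDeriv (e : OpenPartialHomeomorph M (EuclideanSpace ℝ (Fin d))) (i : Fin d)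
    (f : M → ℝ) (p : M) : ℝ :=
  fderiv ℝ (fun y => f (e.symm y)) (e p) (EuclideanSpace.single i (1 : ℝ))

/-- Smooth Riemannian metrics on `M`. -/
abbrev RiemMetric (d : ℕ) (M : Type*) [TopologicalSpace M]
    [ChartedSpace (EuclideanSpace ℝ (Fin d)) M] [IsManifold (𝓡 d) ∞ M] :=
  Bundle.ContMDiffRiemannianMetric (𝓡 d) ∞ (EuclideanSpace ℝ (Fin d))
    (fun p : M => TangentSpace (𝓡 d) p)

variable [IsManifold (𝓡 d) ∞ M]

/-- The matrix `gᵢⱼ = g(∂ᵢ, ∂ⱼ)` of the metric at `p` in the chart `e`. -/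
def metricMatrix (g : RiemMetric d M) (e : OpenPartialHomeomorph M (EuclideanSpace ℝ (Fin d)))
    (p : M) : Matrix (Fin d) (Fin d) ℝ :=
  Matrix.of fun i j => g.inner p (frame e p i) (frame e p j)

/-- The Christoffel symbols
`Γᵏᵢⱼ = ½ ∑ₗ gᵏˡ (∂ᵢ gⱼₗ + ∂ⱼ gᵢₗ - ∂ₗ gᵢⱼ)` of the Riemannian (Levi-Civita) connection. -/
def christoffel (g : RiemMetric d M) (e : OpenPartialHomeomorph M (EuclideanSpace ℝ (Fin d)))
    (k i j : Fin d) (p : M) : ℝ :=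
  (1 / 2 : ℝ) * ∑ l, (metricMatrix g e p)⁻¹ k l *
    (partialDeriv e i (fun q => metricMatrix g e q j l) p
      + partialDeriv e j (fun q => metricMatrix g e q i l) p
      - partialDeriv e l (fun q => metricMatrix g e q i j) p)

/-- The coefficients of the curvature tensor `K(X, Y) = [∇_X, ∇_Y] - ∇_[X, Y]`:
`K(∂ᵢ, ∂ⱼ) ∂ₖ = ∑ₗ (∂ᵢ Γˡⱼₖ - ∂ⱼ Γˡᵢₖ + ∑ₛ (Γˡᵢₛ Γˢⱼₖ - Γˡⱼₛ Γˢᵢₖ)) ∂ₗ`. -/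
def curvatureCoeff (g : RiemMetric d M) (e : OpenPartialHomeomorph M (EuclideanSpace ℝ (Fin d)))
    (l i j k : Fin d) (p : M) : ℝ :=
  partialDeriv e i (christoffel g e l j k) p - partialDeriv e j (christoffel g e l i k) p
    + ∑ s, (christoffel g e l i s p * christoffel g e s j k p
      - christoffel g e l j s p * christoffel g e s i k p)

/-- The vector `K(X, Y) Z` at `p`, for the Riemannian curvature tensor `K`, computed in the
chart `e`. -/
def curvature (g : RiemMetric d M) (e : OpenPartialHomeomorph M (EuclideanSpace ℝ (Fin d)))
    (p : M) (X Y Z : TangentSpace (𝓡 d) p) : TangentSpace (𝓡 d) p :=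
  ∑ l, (∑ i, ∑ j, ∑ k,
    coord e p X i * coord e p Y j * coord e p Z k * curvatureCoeff g e l i j k p) • frame e p l

/-- The Ricci tensor: `Ric(Y, Z)` is the trace of `X ↦ K(X, Y) Z`. -/
def ricci (g : RiemMetric d M) (e : OpenPartialHomeomorph M (EuclideanSpace ℝ (Fin d)))
    (p : M) (Y Z : TangentSpace (𝓡 d) p) : ℝ :=
  ∑ i, coord e p (curvature g e p (frame e p i) Y Z) i

/-- The scalar curvature `τ = ∑ⱼₖ gʲᵏ Ric(∂ⱼ, ∂ₖ)`. -/
def scalarCurvature (g : RiemMetric d M)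
    (e : OpenPartialHomeomorph M (EuclideanSpace ℝ (Fin d))) (p : M) : ℝ :=
  ∑ j, ∑ k, (metricMatrix g e p)⁻¹ j k * ricci g e p (frame e p j) (frame e p k)

/-- The Hessian `(Hess f)(∂ᵢ, ∂ⱼ) = ∂ᵢ ∂ⱼ f - ∑ₖ Γᵏᵢⱼ ∂ₖ f` of a function `f`. -/
def hessian (g : RiemMetric d M) (e : OpenPartialHomeomorph M (EuclideanSpace ℝ (Fin d)))
    (f : M → ℝ) (p : M) (X Y : TangentSpace (𝓡 d) p) : ℝ :=
  ∑ i, ∑ j, coord e p X i * coord e p Y j *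
    (partialDeriv e i (partialDeriv e j f) p
      - ∑ k, christoffel g e k i j p * partialDeriv e k f p)

/-- A 1-form is closed: `∂ᵢ αⱼ = ∂ⱼ αᵢ` in every smooth chart. -/
def IsClosedOneForm (α : ∀ p : M, TangentSpace (𝓡 d) p → ℝ) : Prop :=
  ∀ e ∈ SmoothCharts d M, ∀ p ∈ e.source, ∀ i j,
    partialDeriv e i (fun q => α q (frame e q j)) p
      = partialDeriv e j (fun q => α q (frame e q i)) p

/-- A 2-form is closed: `∂ᵢ βⱼₖ + ∂ⱼ βₖᵢ + ∂ₖ βᵢⱼ = 0` in every smooth chart. -/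
def IsClosedTwoForm (β : ∀ p : M, TangentSpace (𝓡 d) p → TangentSpace (𝓡 d) p → ℝ) : Prop :=
  ∀ e ∈ SmoothCharts d M, ∀ p ∈ e.source, ∀ i j k,
    partialDeriv e i (fun q => β q (frame e q j) (frame e q k)) p
      + partialDeriv e j (fun q => β q (frame e q k) (frame e q i)) p
      + partialDeriv e k (fun q => β q (frame e q i) (frame e q j)) p = 0

/-- The `κ`-nullity distribution
`N_p(κ) = {Z ∈ T_pM : K(X, Y) Z = κ (g(Y, Z) X - g(X, Z) Y) for all X, Y ∈ T_pM}`. -/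
def nullityDistribution (g : RiemMetric d M) (κ : ℝ) (p : M) : Set (TangentSpace (𝓡 d) p) :=
  {Z | ∀ e ∈ SmoothCharts d M, p ∈ e.source → ∀ X Y : TangentSpace (𝓡 d) p,
    curvature g e p X Y Z = κ • (g.inner p Y Z • X - g.inner p X Z • Y)}

/-- `f` is the potential function of an `(m, ρ)`-quasi-Einstein structure with constant `lam`
on `(M, g)`: the function `f` is smooth and
`Ric + Hess f - (1/m) df ⊗ df = (ρ τ + lam) g`. Here `0 < m ≤ ∞`, and `1/∞ = 0`. -/
structure IsQuasiEinstein (g : RiemMetric d M) (m : ℝ≥0∞) (ρ lam : ℝ) (f : M → ℝ) : Prop where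
  pos : 0 < m
  smooth : ContMDiff (𝓡 d) 𝓘(ℝ, ℝ) ∞ f
  eqn : ∀ e ∈ SmoothCharts d M, ∀ p ∈ e.source, ∀ X Y : TangentSpace (𝓡 d) p,
    ricci g e p X Y + hessian g e f p X Y
        - (m⁻¹).toReal * (mvfderiv (𝓡 d) f p X * mvfderiv (𝓡 d) f p Y)
      = (ρ * scalarCurvature g e p + lam) * g.inner p X Y

end Charts

/-- An almost contact metric structure `(φ, ζ, η, g)` on a smooth manifold of
dimension `2n + 1`. -/
structure AlmostContactMetric (n : ℕ) (M : Type*) [TopologicalSpace M]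
    [ChartedSpace (EuclideanSpace ℝ (Fin (2 * n + 1))) M]
    [IsManifold (𝓡 (2 * n + 1)) ∞ M] where
  /-- the Riemannian metric -/
  g : RiemMetric (2 * n + 1) M
  /-- the (1,1)-tensor field -/
  φ : ∀ p : M, TangentSpace (𝓡 (2 * n + 1)) p →L[ℝ] TangentSpace (𝓡 (2 * n + 1)) p
  /-- the structure (Reeb) vector field -/
  ζ : ∀ p : M, TangentSpace (𝓡 (2 * n + 1)) p
  /-- the 1-form -/
  η : ∀ p : M, TangentSpace (𝓡 (2 * n + 1)) p →L[ℝ] ℝ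
  smooth_φ : ContMDiff (𝓡 (2 * n + 1))
    ((𝓡 (2 * n + 1)).prod
      𝓘(ℝ, EuclideanSpace ℝ (Fin (2 * n + 1)) →L[ℝ] EuclideanSpace ℝ (Fin (2 * n + 1)))) ∞
    (fun p => Bundle.TotalSpace.mk'
      (EuclideanSpace ℝ (Fin (2 * n + 1)) →L[ℝ] EuclideanSpace ℝ (Fin (2 * n + 1)))
      (E := fun p : M =>
        TangentSpace (𝓡 (2 * n + 1)) p →L[ℝ] TangentSpace (𝓡 (2 * n + 1)) p) p (φ p))
  smooth_ζ : ContMDiff (𝓡 (2 * n + 1)) ((𝓡 (2 * n + 1)).prod (𝓡 (2 * n + 1))) ∞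
    (fun p => Bundle.TotalSpace.mk' (EuclideanSpace ℝ (Fin (2 * n + 1)))
      (E := fun p : M => TangentSpace (𝓡 (2 * n + 1)) p) p (ζ p))
  smooth_η : ContMDiff (𝓡 (2 * n + 1))
    ((𝓡 (2 * n + 1)).prod 𝓘(ℝ, EuclideanSpace ℝ (Fin (2 * n + 1)) →L[ℝ] ℝ)) ∞
    (fun p => Bundle.TotalSpace.mk' (EuclideanSpace ℝ (Fin (2 * n + 1)) →L[ℝ] ℝ)
      (E := fun p : M => TangentSpace (𝓡 (2 * n + 1)) p →L[ℝ] ℝ) p (η p))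
  φ_sq : ∀ (p : M) (X : TangentSpace (𝓡 (2 * n + 1)) p), φ p (φ p X) + X = η p X • ζ p
  η_ζ : ∀ p : M, η p (ζ p) = 1
  compatible : ∀ (p : M) (X Y : TangentSpace (𝓡 (2 * n + 1)) p),
    g.inner p X Y = g.inner p (φ p X) (φ p Y) + η p X * η p Y

/-- The structure is almost co-Kähler: `dη = 0` and `dΦ = 0`, where `Φ(X, Y) = g(X, φ Y)`. -/
structure AlmostContactMetric.IsAlmostCoKahler {n : ℕ} {M : Type*} [TopologicalSpace M]
    [ChartedSpace (EuclideanSpace ℝ (Fin (2 * n + 1))) M]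
    [IsManifold (𝓡 (2 * n + 1)) ∞ M] (S : AlmostContactMetric n M) : Prop where
  closed_η : IsClosedOneForm fun (p : M) X => S.η p X
  closed_Φ : IsClosedTwoForm fun (p : M) X Y => S.g.inner p X (S.φ p Y)

end AlmostCoKahler

end

/-! ### Index-free Levi-Civita calculus and the symmetries of curvature. -/

namespace AlmostCoKahler

/-! Let A = ∇ζ. Closedness of η makes A symmetric, closedness of Φ makes it anticommute with φ
(`φ_A`), and the nullity condition then yields A² = -κ(I - η ⊗ ζ) (`A_A`). Since κ ≠ 0, A is
invertible on ker η. This is rigid enough to determine ∇A and ∇φ (`dA_eq`, `dφ_eq`), then the whole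
curvature tensor (`K_eq`), and hence Ric = 2nκ η ⊗ η (`ricci_eq`).

A quasi-Einstein potential ω therefore satisfies Hess ω = s dω ⊗ dω + μ g - 2nκ η ⊗ η with s = 1/m
and some function μ; the particular form of μ plays no role. Commuting covariant derivatives
(`hessian_codazzi`) and inserting X, ζ, Z with X, Z orthogonal to ζ gives 2nκ g(AX, Z) = c g(X, Z)
for a function c. Replacing X, Z by φX, φZ changes the sign of the left side, since A anticommutes
with φ, but preserves the right side. So A = 0, which contradicts A² = -κ(I - η ⊗ ζ)
(`not_quasiEinstein`).

The computation is carried out over an abstract ring of functions R and a module V of vector fields,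
assumed free and finite once traces are taken. It is then applied to R = smooth functions on the
image of a single chart and V = Rᵈ, where the Christoffel symbols supply the connection. -/

/-- Vector fields `V` over a ring of functions `R`, with a metric and its Levi-Civita connection. -/
structure LeviCivitaCalculus (R V : Type*) [CommRing R] [Algebra ℝ R] [AddCommGroup V]
    [Module R V] where
  /-- the directional derivative of functions -/
  D : V →ₗ[R] Derivation ℝ R R
  /-- the connection -/
  nabla : V → V → V
  /-- the metric -/
  g : V →ₗ[R] V →ₗ[R] R
  nabla_add_left : ∀ X Y Z, nabla (X + Y) Z = nabla X Z + nabla Y Z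
  nabla_smul_left : ∀ (f : R) X Z, nabla (f • X) Z = f • nabla X Z
  nabla_add_right : ∀ X Y Z, nabla X (Y + Z) = nabla X Y + nabla X Z
  nabla_smul_right : ∀ X (f : R) Y, nabla X (f • Y) = f • nabla X Y + D X f • Y
  g_symm : ∀ X Y, g X Y = g Y X
  g_nondeg : ∀ X, (∀ Y, g X Y = 0) → X = 0
  compat : ∀ X Y Z, D X (g Y Z) = g (nabla X Y) Z + g Y (nabla X Z)
  torsion : ∀ X Y f, D X (D Y f) - D Y (D X f) = D (nabla X Y - nabla Y X) f
  faithful : ∀ X, (∀ f, D X f = 0) → X = 0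

theorem eq_zero_of_two_mul {R : Type*} [CommRing R] [Algebra ℝ R] {x : R} (h : 2 * x = 0) :
    x = 0 := by
  have h1 : algebraMap ℝ R (1 / 2) * 2 = 1 := by
    rw [← map_ofNat (algebraMap ℝ R) 2, ← map_mul]; norm_num
  linear_combination algebraMap ℝ R (1 / 2) * h - x * h1

theorem eq_zero_of_two_smul {R V : Type*} [CommRing R] [Algebra ℝ R] [AddCommGroup V] [Module R V]
    {v : V} (h : (2 : R) • v = 0) : v = 0 := by
  have h1 : algebraMap ℝ R (1 / 2) * 2 = 1 := by
    rw [← map_ofNat (algebraMap ℝ R) 2, ← map_mul]; norm_num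
  rw [← one_smul R v, ← h1, mul_smul, h, smul_zero]

namespace LeviCivitaCalculus

variable {R V : Type*} [CommRing R] [Algebra ℝ R] [AddCommGroup V] [Module R V]
  (C : LeviCivitaCalculus R V)

theorem nabla_neg_right (X Y : V) : C.nabla X (-Y) = -C.nabla X Y := by
  have := C.nabla_smul_right X (-1) Y
  simpa using this

theorem nabla_neg_left (X Y : V) : C.nabla (-X) Y = -C.nabla X Y := by
  have := C.nabla_smul_left (-1) X Y
  simpa using this

theorem nabla_sub_right (X Y Z : V) : C.nabla X (Y - Z) = C.nabla X Y - C.nabla X Z := by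
  rw [sub_eq_add_neg, C.nabla_add_right, C.nabla_neg_right, sub_eq_add_neg]

theorem nabla_sub_left (X Y Z : V) : C.nabla (X - Y) Z = C.nabla X Z - C.nabla Y Z := by
  rw [sub_eq_add_neg, C.nabla_add_left, C.nabla_neg_left, sub_eq_add_neg]

theorem nabla_zero_right (X : V) : C.nabla X 0 = 0 := by
  simpa using C.nabla_sub_right X 0 0

theorem ext_inner {X Y : V} (h : ∀ Z, C.g X Z = C.g Y Z) : X = Y :=
  sub_eq_zero.1 <| C.g_nondeg _ fun Z => by simp [h Z]

/-- The Lie bracket of vector fields. -/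
def bracket (X Y : V) : V := C.nabla X Y - C.nabla Y X

theorem D_bracket (X Y : V) (f : R) :
    C.D (C.bracket X Y) f = C.D X (C.D Y f) - C.D Y (C.D X f) := (C.torsion X Y f).symm

/-- The bracket is defined through the connection, so Jacobi is not built in. It holds because
brackets act on functions as commutators and this action is faithful. -/
theorem bracket_jacobi (X Y Z : V) :
    C.bracket X (C.bracket Y Z) + C.bracket Y (C.bracket Z X)
      + C.bracket Z (C.bracket X Y) = 0 := by
  refine C.faithful _ fun f => ?_
  simp only [map_add, Derivation.add_apply, D_bracket, map_sub]
  ring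

/-- The curvature `K(X, Y) = [∇_X, ∇_Y] - ∇_[X, Y]`. -/
def K (X Y Z : V) : V :=
  C.nabla X (C.nabla Y Z) - C.nabla Y (C.nabla X Z) - C.nabla (C.bracket X Y) Z

theorem K_antisymm (X Y Z : V) : C.K Y X Z = -C.K X Y Z := by
  simp only [K, bracket, nabla_sub_left]; abel

theorem K_add_left (X X' Y Z : V) : C.K (X + X') Y Z = C.K X Y Z + C.K X' Y Z := by
  simp only [K, bracket, nabla_sub_left, nabla_add_left, nabla_add_right]; abel

theorem K_smul_left (f : R) (X Y Z : V) : C.K (f • X) Y Z = f • C.K X Y Z := by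
  simp only [K, bracket, nabla_sub_left, nabla_smul_left, nabla_smul_right, nabla_add_left]
  module

theorem K_add_right (X Y Z Z' : V) : C.K X Y (Z + Z') = C.K X Y Z + C.K X Y Z' := by
  simp only [K, nabla_add_right]; abel

theorem K_smul_right (X Y : V) (f : R) (Z : V) : C.K X Y (f • Z) = f • C.K X Y Z := by
  simp only [K, nabla_smul_right, nabla_add_right, C.D_bracket]
  module

/-- The curvature as a linear map in each of its arguments. -/
def curv : V →ₗ[R] V →ₗ[R] V →ₗ[R] V :=
  LinearMap.mk₂ R
    (fun X Y => ⟨⟨C.K X Y, C.K_add_right X Y⟩, fun f Z => C.K_smul_right X Y f Z⟩)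
    (fun X X' Y => by ext Z; exact C.K_add_left X X' Y Z)
    (fun f X Y => by ext Z; exact C.K_smul_left f X Y Z)
    (fun X Y Y' => by
      ext Z
      change C.K X (Y + Y') Z = C.K X Y Z + C.K X Y' Z
      rw [C.K_antisymm (Y + Y') X, C.K_add_left, C.K_antisymm X Y, C.K_antisymm X Y']; abel)
    (fun f X Y => by
      ext Z
      change C.K X (f • Y) Z = f • C.K X Y Z
      rw [C.K_antisymm (f • Y) X, C.K_smul_left, C.K_antisymm X Y]; simp)

@[simp] theorem curv_apply (X Y Z : V) : C.curv X Y Z = C.K X Y Z := rfl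

theorem K_bianchi (X Y Z : V) : C.K X Y Z + C.K Y Z X + C.K Z X Y = 0 := by
  have h := C.bracket_jacobi X Y Z
  simp only [K, bracket, nabla_sub_left, nabla_sub_right] at h ⊢
  rw [← h]; abel

theorem K_skew (X Y Z W : V) : C.g (C.K X Y Z) W = -C.g (C.K X Y W) Z := by
  have h := C.D_bracket X Y (C.g Z W)
  simp only [C.compat, map_add] at h
  simp only [K, map_sub, LinearMap.sub_apply]
  linear_combination -h + C.g_symm (C.nabla X (C.nabla Y W)) Z
    - C.g_symm (C.nabla Y (C.nabla X W)) Z - C.g_symm (C.nabla (C.bracket X Y) W) Z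

/-- The octahedron argument: in a signed sum of four Bianchi identities, skewness in each pair
cancels everything except twice the difference of the two sides. -/
theorem K_pair (X Y Z W : V) : C.g (C.K X Y Z) W = C.g (C.K Z W X) Y := by
  have b (X Y Z W : V) : C.g (C.K X Y Z) W + C.g (C.K Y Z X) W + C.g (C.K Z X Y) W = 0 := by
    rw [← LinearMap.add_apply, ← LinearMap.add_apply, ← map_add, ← map_add, C.K_bianchi]; simp
  have s (X Y Z W : V) : C.g (C.K Y X Z) W = -C.g (C.K X Y Z) W := by rw [C.K_antisymm]; simp
  refine sub_eq_zero.1 (eq_zero_of_two_mul ?_)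
  linear_combination b X Y Z W + b Y Z W X - b Z W X Y - b W X Y Z
    - C.K_skew Y Z W X - C.K_skew Z W Y X - s Y W Z X
    + s X W Z Y - C.K_skew X W Z Y + s Z X W Y - C.K_skew Z X W Y
    + s X W Y Z + C.K_skew X Y W Z + C.K_skew Y W X Z

end LeviCivitaCalculus
end AlmostCoKahler

/-! ### The operator A = ∇ζ under the nullity condition. -/

namespace AlmostCoKahler
namespace LeviCivitaCalculus

variable {R V : Type*} [CommRing R] [Algebra ℝ R] [AddCommGroup V] [Module R V]
  {C : LeviCivitaCalculus R V}

/-- An almost co-Kähler structure on a calculus whose Reeb field lies in the `κ`-nullity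
distribution. -/
structure Nullity (C : LeviCivitaCalculus R V) (κ : ℝ) where
  /-- the structure tensor -/
  φ : V →ₗ[R] V
  /-- the Reeb field -/
  ζ : V
  φ_sq : ∀ X, φ (φ X) = -X + C.g X ζ • ζ
  φ_ζ : φ ζ = 0
  unit_ζ : C.g ζ ζ = 1
  φ_skew : ∀ X Y, C.g (φ X) Y = -C.g X (φ Y)
  -- For a torsion-free connection, dη = 0 is the symmetry of ∇ζ, and dΦ = 0 is the vanishing of the
  -- cyclic sum of g((∇_X φ)Y, Z).
  closed_η : ∀ X Y, C.g (C.nabla X ζ) Y = C.g (C.nabla Y ζ) X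
  closed_Φ : ∀ X Y Z, C.g (C.nabla X (φ Y) - φ (C.nabla X Y)) Z
    + C.g (C.nabla Y (φ Z) - φ (C.nabla Y Z)) X
    + C.g (C.nabla Z (φ X) - φ (C.nabla Z X)) Y = 0
  nullity : ∀ X Y, C.K X Y ζ = algebraMap ℝ R κ • (C.g Y ζ • X - C.g X ζ • Y)

namespace Nullity

variable {κ : ℝ} (S : C.Nullity κ)

/-- The shape operator `A X = ∇_X ζ`. -/
def A : V →ₗ[R] V where
  toFun X := C.nabla X S.ζ
  map_add' X Y := C.nabla_add_left X Y _
  map_smul' f X := C.nabla_smul_left f X _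

theorem nabla_ζ (X : V) : C.nabla X S.ζ = S.A X := rfl

theorem A_symm (X Y : V) : C.g (S.A X) Y = C.g X (S.A Y) :=
  (S.closed_η X Y).trans (C.g_symm _ _)

theorem g_A_ζ (X : V) : C.g (S.A X) S.ζ = 0 := by
  have h := C.compat X S.ζ S.ζ
  rw [S.unit_ζ, Derivation.map_one_eq_zero, S.nabla_ζ, C.g_symm S.ζ] at h
  exact eq_zero_of_two_mul (by linear_combination -h)

theorem A_ζ : S.A S.ζ = 0 :=
  C.g_nondeg _ fun Y => by rw [S.A_symm, C.g_symm, S.g_A_ζ]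

theorem g_φ_ζ (X : V) : C.g (S.φ X) S.ζ = 0 := by rw [S.φ_skew, S.φ_ζ]; simp

theorem g_φ_φ (X Y : V) : C.g (S.φ X) (S.φ Y) = C.g X Y - C.g X S.ζ * C.g Y S.ζ := by
  rw [S.φ_skew, S.φ_sq]; simp; ring

theorem D_η (X Y : V) : C.D X (C.g Y S.ζ) = C.g (C.nabla X Y) S.ζ + C.g Y (S.A X) :=
  C.compat X Y S.ζ

theorem D_κ (X : V) (r : ℝ) : C.D X (algebraMap ℝ R r) = 0 := Derivation.map_algebraMap _ _

/-- The covariant derivative `(∇_X T) Y` of an endomorphism field `T`. -/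
def dT (T : V →ₗ[R] V) (X Y : V) : V := C.nabla X (T Y) - T (C.nabla X Y)

theorem nabla_T (T : V →ₗ[R] V) (X Y : V) :
    C.nabla X (T Y) = dT (C := C) T X Y + T (C.nabla X Y) := by simp [dT]

theorem dT_add (T : V →ₗ[R] V) (X Y Z : V) :
    dT (C := C) T X (Y + Z) = dT (C := C) T X Y + dT (C := C) T X Z := by
  simp only [dT, map_add, C.nabla_add_right]; abel

theorem dT_smul (T : V →ₗ[R] V) (X : V) (f : R) (Y : V) :
    dT (C := C) T X (f • Y) = f • dT (C := C) T X Y := by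
  simp only [dT, map_add, map_smul, C.nabla_smul_right]; module

theorem dT_add_left (T : V →ₗ[R] V) (X Y Z : V) :
    dT (C := C) T (X + Y) Z = dT (C := C) T X Z + dT (C := C) T Y Z := by
  simp only [dT, map_add, C.nabla_add_left]; abel

theorem dT_smul_left (T : V →ₗ[R] V) (f : R) (X Y : V) :
    dT (C := C) T (f • X) Y = f • dT (C := C) T X Y := by
  simp only [dT, map_smul, C.nabla_smul_left]; module

theorem dφ_ζ (X : V) : dT (C := C) S.φ X S.ζ = -S.φ (S.A X) := by
  have h0 : C.nabla X (0 : V) = 0 := C.nabla_zero_right X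
  simp [dT, S.φ_ζ, h0, S.nabla_ζ]

theorem dA_ζ (X : V) : dT (C := C) S.A X S.ζ = -S.A (S.A X) := by
  have h0 : C.nabla X (0 : V) = 0 := C.nabla_zero_right X
  simp [dT, S.A_ζ, h0, S.nabla_ζ]

theorem g_dφ (X Y Z : V) :
    C.g (dT (C := C) S.φ X Y) Z = -C.g (dT (C := C) S.φ X Z) Y := by
  have h := congrArg (C.D X) (S.φ_skew Y Z)
  rw [map_neg, C.compat, C.compat, nabla_T, nabla_T] at h
  simp only [map_add, LinearMap.add_apply] at h
  linear_combination h - S.φ_skew (C.nabla X Y) Z - C.g_symm Y (dT (C := C) S.φ X Z)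
    - S.φ_skew Y (C.nabla X Z)

theorem g_dA (X Y Z : V) :
    C.g (dT (C := C) S.A X Y) Z = C.g (dT (C := C) S.A X Z) Y := by
  have h := congrArg (C.D X) (S.A_symm Y Z)
  rw [C.compat, C.compat, nabla_T, nabla_T] at h
  simp only [map_add, LinearMap.add_apply] at h
  linear_combination h - S.A_symm (C.nabla X Y) Z + C.g_symm Y (dT (C := C) S.A X Z)
    - S.A_symm Y (C.nabla X Z)

/-- The derivative of `φ² = -I + η ⊗ ζ`. -/
theorem dφ_sq (X Y : V) : dT (C := C) S.φ X (S.φ Y) + S.φ (dT (C := C) S.φ X Y)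
    = C.g Y (S.A X) • S.ζ + C.g Y S.ζ • S.A X := by
  have h := congrArg (C.nabla X) (S.φ_sq Y)
  rw [nabla_T, nabla_T, map_add, S.φ_sq, C.nabla_add_right, C.nabla_neg_right,
    C.nabla_smul_right, S.nabla_ζ, S.D_η] at h
  linear_combination (norm := module) h

/-- `L_ζ Φ = 0` in terms of the connection. -/
theorem dφ_of_ζ (Y : V) : dT (C := C) S.φ S.ζ Y = -(S.A (S.φ Y) + S.φ (S.A Y)) := by
  refine C.ext_inner fun Z => ?_
  have h := S.closed_Φ S.ζ Y Z
  change C.g (dT (C := C) S.φ S.ζ Y) Z + C.g (dT (C := C) S.φ Y Z) S.ζ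
    + C.g (dT (C := C) S.φ Z S.ζ) Y = 0 at h
  rw [S.g_dφ Y Z, S.dφ_ζ, S.dφ_ζ] at h
  simp only [map_neg, map_add, LinearMap.neg_apply, LinearMap.add_apply] at h ⊢
  linear_combination h + S.φ_skew (S.A Z) Y - S.A_symm Z (S.φ Y) - C.g_symm Z (S.A (S.φ Y))

/-- Differentiating φ² along ζ gives zero because Aζ = 0, so ∇_ζ φ = -(Aφ + φA) anticommutes with φ.
Expanding with φ² = -I + η ⊗ ζ leaves 2(φAφ - A) = 0. -/
theorem φ_anticomm_aux (Y : V) : S.φ (S.A (S.φ Y)) = S.A Y := by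
  have h1 := S.dφ_sq S.ζ Y
  simp only [S.dφ_of_ζ, S.A_ζ, map_zero, smul_zero, zero_smul, add_zero, map_neg, map_add,
    S.φ_sq, S.g_A_ζ, map_smul] at h1
  have h2 : (2 : R) • (S.φ (S.A (S.φ Y)) - S.A Y) = 0 := by
    linear_combination (norm := module) -h1
  exact sub_eq_zero.1 (eq_zero_of_two_smul h2)

theorem φ_A (Y : V) : S.φ (S.A Y) = -S.A (S.φ Y) := by
  have h := congrArg S.φ (S.φ_anticomm_aux Y)
  rw [S.φ_sq, S.g_A_ζ] at h
  rw [← h]; simp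

theorem dφ_along_ζ (Y : V) : dT (C := C) S.φ S.ζ Y = 0 := by
  rw [S.dφ_of_ζ, S.φ_A]; simp

/-- As A = ∇ζ, the skew part of ∇A is K(X, Y)ζ. -/
theorem codazzi (X Y : V) : dT (C := C) S.A X Y - dT (C := C) S.A Y X
    = algebraMap ℝ R κ • (C.g Y S.ζ • X - C.g X S.ζ • Y) := by
  rw [← S.nullity]
  simp only [K, bracket, C.nabla_sub_left, dT, S.nabla_ζ]
  abel

theorem dA_along_ζ_aux (X : V) : dT (C := C) S.A S.ζ X
    = -S.A (S.A X) - algebraMap ℝ R κ • (X - C.g X S.ζ • S.ζ) := by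
  have h := S.codazzi X S.ζ
  rw [S.dA_ζ, S.unit_ζ] at h
  linear_combination (norm := module) -h

theorem dφ_A (X Y : V) : dT (C := C) S.φ X (S.A Y) + S.φ (dT (C := C) S.A X Y)
    = -(dT (C := C) S.A X (S.φ Y) + S.A (dT (C := C) S.φ X Y)) := by
  have h := congrArg (C.nabla X) (S.φ_A Y)
  rw [nabla_T, nabla_T, map_add, S.φ_A (C.nabla X Y), C.nabla_neg_right, nabla_T, nabla_T,
    map_add] at h
  linear_combination (norm := module) h

/-- By `dA_along_ζ_aux`, ∇_ζ A is built from A² and the projection onto ker η, so it commutes with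
φ. Differentiating φA = -Aφ along ζ, where ∇_ζ φ = 0, shows that it also anticommutes with φ. -/
theorem φ_dA_along_ζ (X : V) : S.φ (dT (C := C) S.A S.ζ X) = 0 := by
  have h := S.dφ_A S.ζ X
  rw [S.dφ_along_ζ, S.dφ_along_ζ, map_zero, add_zero, zero_add, S.dA_along_ζ_aux (S.φ X)] at h
  rw [S.dA_along_ζ_aux] at h ⊢
  simp only [map_sub, map_neg, map_smul, S.φ_A, S.φ_ζ, S.g_φ_ζ] at h ⊢
  have h2 : (2 : R) • (S.A (S.A (S.φ X)) + algebraMap ℝ R κ • S.φ X) = 0 := by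
    linear_combination (norm := module) -h
  have h3 : S.A (S.A (S.φ X)) + algebraMap ℝ R κ • S.φ X = 0 :=
    eq_zero_of_two_smul h2
  linear_combination (norm := module) -h3

/-- Another φ applied to φ(∇_ζ A) = 0 gives ∇_ζ A = 0, since ∇_ζ A takes values orthogonal to ζ.
`dA_along_ζ_aux` then determines A². -/
theorem A_A (X : V) : S.A (S.A X) = -(algebraMap ℝ R κ • (X - C.g X S.ζ • S.ζ)) := by
  have h := congrArg S.φ (S.φ_dA_along_ζ X)
  rw [S.φ_sq, S.dA_along_ζ_aux, map_zero] at h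
  have h0 : C.g (S.A (S.A X)) S.ζ = 0 := S.g_A_ζ _
  simp only [map_sub, map_neg, map_smul, LinearMap.sub_apply, LinearMap.neg_apply,
    LinearMap.smul_apply, h0, S.unit_ζ, smul_eq_mul] at h
  linear_combination (norm := module) h

theorem A_A_eq (X : V) : S.A (S.A X)
    = (-algebraMap ℝ R κ) • X + (algebraMap ℝ R κ * C.g X S.ζ) • S.ζ := by
  rw [S.A_A]; module

theorem dA_along_ζ (X : V) : dT (C := C) S.A S.ζ X = 0 := by
  rw [S.dA_along_ζ_aux, S.A_A]; module

theorem dA_A (X Y : V) : dT (C := C) S.A X (S.A Y) + S.A (dT (C := C) S.A X Y)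
    = algebraMap ℝ R κ • (C.g Y (S.A X) • S.ζ + C.g Y S.ζ • S.A X) := by
  have h := congrArg (C.nabla X) (S.A_A Y)
  rw [nabla_T, nabla_T, map_add, S.A_A, C.nabla_neg_right, C.nabla_smul_right, D_κ,
    C.nabla_sub_right, C.nabla_smul_right, S.nabla_ζ, S.D_η] at h
  linear_combination (norm := module) h

end Nullity
end LeviCivitaCalculus

/-! ### The covariant derivatives of A and φ. -/

namespace LeviCivitaCalculus

variable {R V : Type*} [CommRing R] [Algebra ℝ R] [AddCommGroup V] [Module R V]
  {C : LeviCivitaCalculus R V}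

namespace Nullity

variable {κ : ℝ} (S : C.Nullity κ)

theorem eq_zero_of_κ_mul (hκ : κ ≠ 0) {x : R} (h : algebraMap ℝ R κ * x = 0) : x = 0 := by
  have h1 : algebraMap ℝ R κ⁻¹ * algebraMap ℝ R κ = 1 := by
    rw [← map_mul, inv_mul_cancel₀ hκ, map_one]
  linear_combination algebraMap ℝ R κ⁻¹ * h - x * h1

/-- The covariant derivative of `A`. -/
theorem dA_eq (hκ : κ ≠ 0) (X Y : V) : dT (C := C) S.A X Y = algebraMap ℝ R κ •
    (C.g X Y • S.ζ + C.g Y S.ζ • X - (C.g X S.ζ * C.g Y S.ζ) • S.ζ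
      - (C.g X S.ζ * C.g Y S.ζ) • S.ζ) := by
  -- The trilinear form `c` is the error in the claimed formula. Symmetry of A and Codazzi make it
  -- totally symmetric; the derivative of A² makes it change sign when A moves between the last two
  -- slots.
  obtain ⟨c, hc⟩ : ∃ c : V → V → V → R, ∀ X Y Z, c X Y Z = C.g (dT (C := C) S.A X Y) Z
      - algebraMap ℝ R κ * (C.g X Y * C.g Z S.ζ + C.g Y S.ζ * C.g X Z
        - 2 * C.g X S.ζ * C.g Y S.ζ * C.g Z S.ζ) := ⟨_, fun _ _ _ => rfl⟩
  have c23 (X Y Z) : c X Y Z = c X Z Y := by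
    rw [hc, hc]; linear_combination S.g_dA X Y Z
  have c12 (X Y Z) : c X Y Z = c Y X Z := by
    have h := congrArg (fun v => C.g v Z) (S.codazzi X Y)
    simp only [map_sub, map_smul, LinearMap.sub_apply, LinearMap.smul_apply, smul_eq_mul] at h
    rw [hc, hc]; linear_combination h - algebraMap ℝ R κ * C.g Z S.ζ * C.g_symm X Y
  have cA (X Y Z) : c X (S.A Y) Z = -c X Y (S.A Z) := by
    have h := congrArg (fun v => C.g v Z) (S.dA_A X Y)
    simp only [map_add, map_smul, LinearMap.add_apply, LinearMap.smul_apply, smul_eq_mul,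
      S.A_symm _ Z] at h
    rw [hc, hc, S.g_A_ζ, S.g_A_ζ]
    linear_combination h + algebraMap ℝ R κ * C.g Z S.ζ * (C.g_symm Y (S.A X) + S.A_symm X Y)
      + algebraMap ℝ R κ * C.g Y (S.A X) * C.g_symm S.ζ Z
  have cζ (Y Z) : c S.ζ Y Z = 0 := by
    rw [hc, S.dA_along_ζ, C.g_symm S.ζ Y, C.g_symm S.ζ Z, S.unit_ζ]; simp; ring
  -- By total symmetry the sign changes for every pair of slots. Moving A once around the three
  -- slots flips it three times, so the value equals its own negative.
  have cA0 (X Y Z) : c (S.A X) Y Z = 0 := by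
    apply eq_zero_of_two_mul
    linear_combination c12 (S.A X) Y Z + cA Y X Z - c12 Y X (S.A Z) - cA X Y Z
      + c23 (S.A X) Y Z + c12 (S.A X) Z Y + c23 Z (S.A X) Y - cA Z Y X * 0
      + cA Z Y X - c12 Z (S.A Y) X - c23 (S.A Y) Z X - c12 (S.A Y) X Z
  -- Every vector is a multiple of ζ plus a κ⁻¹-multiple of some A(AX); `c` vanishes on both.
  have c0 (X Y Z) : c X Y Z = 0 := by
    apply eq_zero_of_κ_mul hκ
    have h := cA0 (S.A X) Y Z
    have hz := cζ Y Z
    rw [hc] at h hz ⊢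
    simp only [S.A_A_eq, dT_add_left, dT_smul_left, map_add, map_smul,
      LinearMap.add_apply, LinearMap.smul_apply, smul_eq_mul] at h
    linear_combination -h + algebraMap ℝ R κ * C.g X S.ζ * hz
  refine C.ext_inner fun Z => ?_
  have h := c0 X Y Z
  rw [hc] at h
  simp only [map_sub, map_add, map_smul, LinearMap.sub_apply, LinearMap.add_apply,
    LinearMap.smul_apply, smul_eq_mul]
  linear_combination h + algebraMap ℝ R κ * (C.g X Y - 2 * C.g X S.ζ * C.g Y S.ζ) * C.g_symm Z S.ζ

theorem φ_A_symm (X Y : V) : C.g (S.φ (S.A X)) Y = C.g X (S.φ (S.A Y)) := by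
  rw [S.φ_A, S.φ_A Y, map_neg, map_neg, LinearMap.neg_apply, S.A_symm, S.φ_skew, S.φ_A, map_neg]
  simp

/-- The covariant derivative of `φ`. -/
theorem dφ_eq (hκ : κ ≠ 0) (X Y : V) : dT (C := C) S.φ X Y =
    C.g (S.φ (S.A X)) Y • S.ζ - C.g Y S.ζ • S.φ (S.A X) := by
  -- Again `b` is the error in the claimed formula. It is skew in the last two slots, has vanishing
  -- cyclic sum, and inherits relations with A and φ from the derivatives of φA = -Aφ and of φ².
  obtain ⟨b, hb⟩ : ∃ b : V → V → V → R, ∀ X Y Z, b X Y Z = C.g (dT (C := C) S.φ X Y) Z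
      - (C.g (S.φ (S.A X)) Y * C.g Z S.ζ - C.g Y S.ζ * C.g (S.φ (S.A X)) Z) :=
    ⟨_, fun _ _ _ => rfl⟩
  have b23 (X Y Z) : b X Y Z = -b X Z Y := by
    rw [hb, hb]; linear_combination S.g_dφ X Y Z
  have cyc (X Y Z) : b X Y Z + b Y Z X + b Z X Y = 0 := by
    rw [hb, hb, hb]
    have h (X Y) : C.g (S.φ (S.A X)) Y = C.g (S.φ (S.A Y)) X := by
      rw [S.φ_A_symm, C.g_symm]
    have hΦ := S.closed_Φ X Y Z
    simp only [dT]
    linear_combination hΦ + C.g X S.ζ * h Z Y + C.g Y S.ζ * h X Z + C.g Z S.ζ * h Y X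
  have bA (X Y Z) : b X (S.A Y) Z = -b X Y (S.A Z) := by
    have h := congrArg (fun v => C.g v Z) (S.dφ_A X Y)
    simp only [S.dA_eq hκ, map_add, map_sub, map_neg, map_smul, LinearMap.add_apply,
      LinearMap.sub_apply, LinearMap.neg_apply, LinearMap.smul_apply, smul_eq_mul,
      S.A_symm _ Z, S.φ_ζ, S.g_φ_ζ, map_zero, LinearMap.zero_apply] at h
    have e (Z) : C.g (S.φ (S.A X)) (S.A Z) = algebraMap ℝ R κ * C.g (S.φ X) Z := by
      rw [← S.A_symm, S.φ_A, map_neg, S.A_A]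
      simp [S.g_φ_ζ, Algebra.smul_def]
    rw [hb, hb, S.g_A_ζ, S.g_A_ζ, e Y, e Z]
    linear_combination h - algebraMap ℝ R κ * C.g Z S.ζ * S.φ_skew X Y
      - algebraMap ℝ R κ * C.g X (S.φ Y) * C.g_symm S.ζ Z
  have bφ (X Y Z) : b X (S.φ Y) Z = b X Y (S.φ Z) := by
    have h := congrArg (fun v => C.g v Z) (S.dφ_sq X Y)
    simp only [map_add, map_smul, LinearMap.add_apply, LinearMap.smul_apply, smul_eq_mul,
      S.φ_skew _ Z] at h
    rw [hb, hb, S.g_φ_ζ, S.g_φ_ζ, S.g_φ_φ, S.g_φ_φ, S.g_A_ζ]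
    linear_combination h + C.g Y (S.A X) * C.g_symm S.ζ Z + C.g Z S.ζ * C.g_symm Y (S.A X)
  have bζ (X Z) : b X S.ζ Z = 0 := by
    rw [hb, S.dφ_ζ, S.g_φ_ζ, S.unit_ζ]; simp
  have bAA (X Y Z) : b X (S.A (S.A Y)) Z = -(algebraMap ℝ R κ * b X Y Z) := by
    have hz := bζ X Z
    rw [hb] at hz ⊢
    rw [hb]
    simp only [S.A_A_eq, dT_add, dT_smul, map_add, map_smul, LinearMap.add_apply, LinearMap.smul_apply, smul_eq_mul]
    linear_combination algebraMap ℝ R κ * C.g Y S.ζ * hz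
  -- `q` is symmetric in its first two arguments and `q X Y (φ W)` is skew in `Y` and `W`
  obtain ⟨q, hq⟩ : ∃ q : V → V → V → R, ∀ X Y Z, q X Y Z =
      -(algebraMap ℝ R κ * b X Y Z) + b (S.A X) (S.A Y) Z := ⟨_, fun _ _ _ => rfl⟩
  -- By the cyclic identity, exchanging X and Y costs b(Z, X, Y) in the first term of `q` and b(Z,
  -- AX, AY) = κ b(Z, X, Y) in the second; the weight -κ makes these cancel.
  have q12 (X Y Z) : q X Y Z = q Y X Z := by
    rw [hq, hq]
    linear_combination -algebraMap ℝ R κ * (cyc X Y Z - b23 Y Z X) + cyc (S.A X) (S.A Y) Z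
      - b23 (S.A Y) Z (S.A X) - bA Z (S.A X) Y + bAA Z X Y
  have bn (X Y Z) : b X Y (S.φ (S.A Z)) = -b X Y (S.A (S.φ Z)) := by
    rw [hb, hb, S.φ_A]; simp only [map_neg, LinearMap.neg_apply]; ring
  have qφ (X Y W) : q X Y (S.φ W) = -q X W (S.φ Y) := by
    rw [hq, hq]
    linear_combination -algebraMap ℝ R κ * (b23 X (S.φ Y) W - bφ X Y W)
      - bφ (S.A X) (S.A Y) W + b23 (S.A X) (S.φ (S.A Y)) W - bn (S.A X) W Y
      + bA (S.A X) W (S.φ Y)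
  have bφφ (X Y Z) : b X Y (S.φ (S.φ Z)) = -b X Y Z := by
    have hz : b X Y S.ζ = 0 := by rw [b23, bζ, neg_zero]
    rw [hb] at hz ⊢
    rw [hb, S.φ_sq]
    simp only [map_add, map_neg, map_smul, LinearMap.add_apply, LinearMap.neg_apply,
      LinearMap.smul_apply, smul_eq_mul]
    linear_combination C.g Z S.ζ * hz
  -- A trilinear form symmetric in slots 1, 2 and skew in slots 2, 3 vanishes. This removes q(X, Y,
  -- φW), and a second φ gives -q(X, Y, Z).
  have q0 (X Y Z) : q X Y Z = 0 := by
    have h (X Y W) : q X Y (S.φ W) = 0 := by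
      apply eq_zero_of_two_mul
      linear_combination q12 X Y (S.φ W) + qφ Y X W - q12 Y W (S.φ X) - qφ W Y X
        + q12 W X (S.φ Y) + qφ X Y W
    have h1 := h X Y (S.φ Z)
    rw [hq, bφφ, bφφ] at h1
    rw [hq]; linear_combination -h1
  -- In Y and Z the term -κ b(X, Y, Z) of `q` is skew while b(AX, AY, Z) is symmetric, so the two
  -- vanish separately.
  have b0 (X Y Z) : b X Y Z = 0 := by
    apply eq_zero_of_κ_mul hκ
    apply eq_zero_of_two_mul
    have h1 := q0 X Y Z
    have h2 := q0 X Z Y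
    rw [hq] at h1 h2
    linear_combination -h1 + h2 + algebraMap ℝ R κ * b23 X Y Z
      + b23 (S.A X) (S.A Y) Z - bA (S.A X) Z Y
  refine C.ext_inner fun Z => ?_
  have h := b0 X Y Z
  rw [hb] at h
  simp only [map_sub, map_smul, LinearMap.sub_apply, LinearMap.smul_apply, smul_eq_mul]
  linear_combination h + C.g (S.φ (S.A X)) Y * C.g_symm Z S.ζ

end Nullity
end LeviCivitaCalculus
end AlmostCoKahler

/-! ### The curvature and Ricci tensors, and the contradiction. -/

open scoped TensorProduct

namespace AlmostCoKahler
theorem trace_smulRight {R V : Type*} [CommRing R] [AddCommGroup V] [Module R V]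
    [Module.Free R V] [Module.Finite R V] (f : V →ₗ[R] R) (v : V) :
    LinearMap.trace R V (f.smulRight v) = f v :=
  LinearMap.trace_eq_contract_apply (R := R) (M := V) (f ⊗ₜ v)

namespace LeviCivitaCalculus

variable {R V : Type*} [CommRing R] [Algebra ℝ R] [AddCommGroup V] [Module R V]
  {C : LeviCivitaCalculus R V}

namespace Nullity

variable {κ : ℝ} (S : C.Nullity κ)

/-- The commutator of curvature with an endomorphism field is written through ∇T alone, so that the
explicit formulas for ∇A and ∇φ can be substituted. -/
theorem ricci_identity (T : V →ₗ[R] V) (X Y Z : V) : C.K X Y (T Z) - T (C.K X Y Z)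
    = C.nabla X (dT (C := C) T Y Z) + dT (C := C) T X (C.nabla Y Z)
      - C.nabla Y (dT (C := C) T X Z) - dT (C := C) T Y (C.nabla X Z)
      - dT (C := C) T (C.bracket X Y) Z := by
  simp only [K, dT, C.nabla_sub_right, map_sub]
  abel

/-- The curvature tensor which `κ`-nullity forces. -/
def K₀ (X Y Z : V) : V :=
  C.g (S.A X) Z • S.A Y - C.g (S.A Y) Z • S.A X
    + algebraMap ℝ R κ • ((C.g Y S.ζ * C.g Z S.ζ) • X - (C.g X S.ζ * C.g Z S.ζ) • Y
      + (C.g X S.ζ * C.g Y Z - C.g Y S.ζ * C.g X Z) • S.ζ)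

/-- The Ricci identity computes the left side from the known ∇A. Together with `K_φ` it shows that K
- K₀ commutes with both A and φ. -/
theorem K_A (hκ : κ ≠ 0) (X Y Z : V) :
    C.K X Y (S.A Z) - S.A (C.K X Y Z) = S.K₀ X Y (S.A Z) - S.A (S.K₀ X Y Z) := by
  have e (X Y : V) : C.g (S.A X) (S.A Y)
      = -(algebraMap ℝ R κ * (C.g X Y - C.g X S.ζ * C.g Y S.ζ)) := by
    rw [S.A_symm, S.A_A_eq]
    simp only [map_add, map_smul, smul_eq_mul]; ring
  have e2 : C.g X (S.A Y) = C.g Y (S.A X) := by rw [← S.A_symm, C.g_symm]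
  have e3 (X : V) : C.g Z (S.A X) = C.g X (S.A Z) := by rw [← S.A_symm, C.g_symm]
  rw [ricci_identity]
  simp only [S.dA_eq hκ, K₀, bracket, C.nabla_smul_right, C.nabla_add_right, C.nabla_sub_right,
    D_κ, S.D_η, C.compat, map_sub, map_add, map_smul, Derivation.leibniz, LinearMap.sub_apply,
    S.A_A_eq, e, S.g_A_ζ, S.A_ζ, S.nabla_ζ, smul_eq_mul, S.A_symm X Z, S.A_symm Y Z, e2, e3 X, e3 Y]
  module

theorem K_φ (hκ : κ ≠ 0) (X Y Z : V) :
    C.K X Y (S.φ Z) - S.φ (C.K X Y Z) = S.K₀ X Y (S.φ Z) - S.φ (S.K₀ X Y Z) := by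
  rw [ricci_identity]
  simp only [S.dφ_eq hκ, nabla_T, S.dA_eq hκ, K₀, bracket, C.nabla_smul_right, C.nabla_sub_right,
    S.D_η, C.compat, map_sub, map_add, map_smul, LinearMap.sub_apply, S.g_φ_ζ, S.g_A_ζ,
    S.nabla_ζ, LinearMap.add_apply, LinearMap.smul_apply, S.φ_ζ, map_zero, LinearMap.zero_apply,
    S.φ_skew X Z, S.φ_skew Y Z, smul_eq_mul, C.g_symm S.ζ Z]
  rw [S.φ_skew (S.A X) Z, S.φ_skew (S.A Y) Z, C.g_symm Z (S.A X), C.g_symm Z (S.A Y)]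
  module

theorem K_eq (hκ : κ ≠ 0) (X Y Z : V) : C.K X Y Z = S.K₀ X Y Z := by
  -- The difference `r` of K and K₀ keeps pair symmetry and the Bianchi identity, and A and φ pass
  -- from its third slot to its fourth, up to sign.
  obtain ⟨r, hr⟩ : ∃ r : V → V → V → V → R, ∀ X Y Z W,
      r X Y Z W = C.g (C.K X Y Z) W - C.g (S.K₀ X Y Z) W := ⟨_, fun _ _ _ _ => rfl⟩
  have gA (X Y) : C.g (S.A X) Y = C.g (S.A Y) X := by rw [S.A_symm, C.g_symm]
  have pair (X Y Z W) : r X Y Z W = r Z W X Y := by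
    rw [hr, hr, C.K_pair]
    simp only [K₀, map_add, map_sub, map_smul, LinearMap.add_apply, LinearMap.sub_apply,
      LinearMap.smul_apply, smul_eq_mul, C.g_symm S.ζ, gA Z X, gA Z Y, gA W X, gA W Y,
      C.g_symm Z X, C.g_symm Z Y, C.g_symm W X, C.g_symm W Y]
    ring
  have bianchi (X Y Z W) : r X Y Z W + r Y Z X W + r Z X Y W = 0 := by
    have h := congrArg (fun v => C.g v W) (C.K_bianchi X Y Z)
    simp only [map_add, map_zero, LinearMap.add_apply, LinearMap.zero_apply] at h
    rw [hr, hr, hr]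
    simp only [K₀, map_add, map_sub, map_smul, LinearMap.add_apply, LinearMap.sub_apply,
      LinearMap.smul_apply, smul_eq_mul, gA Z X, gA Z Y, gA Y X, C.g_symm Z X, C.g_symm Z Y,
      C.g_symm Y X]
    linear_combination h
  have rA (X Y Z W) : r X Y (S.A Z) W = r X Y Z (S.A W) := by
    have h := congrArg (fun v => C.g v W) (S.K_A hκ X Y Z)
    simp only [map_sub, LinearMap.sub_apply, S.A_symm _ W] at h
    rw [hr, hr]; linear_combination h
  have rφ (X Y Z W) : r X Y (S.φ Z) W = -r X Y Z (S.φ W) := by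
    have h := congrArg (fun v => C.g v W) (S.K_φ hκ X Y Z)
    simp only [map_sub, LinearMap.sub_apply, S.φ_skew _ W] at h
    rw [hr, hr]; linear_combination h
  have add (X Y Z Z' W) : r X Y (Z + Z') W = r X Y Z W + r X Y Z' W := by
    rw [hr, hr, hr, C.K_add_right]
    simp only [K₀, map_add, map_sub, map_smul, LinearMap.add_apply, LinearMap.sub_apply,
      LinearMap.smul_apply, smul_eq_mul]
    ring
  have smul (X Y) (f : R) (Z W) : r X Y (f • Z) W = f * r X Y Z W := by
    rw [hr, hr, C.K_smul_right]
    simp only [K₀, map_add, map_sub, map_smul, LinearMap.add_apply, LinearMap.sub_apply,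
      LinearMap.smul_apply, smul_eq_mul]
    ring
  have ζ0 (X Y W) : r X Y S.ζ W = 0 := by
    rw [hr, S.nullity]
    simp only [K₀, S.g_A_ζ, S.unit_ζ, map_add, map_sub, map_smul, LinearMap.add_apply,
      LinearMap.sub_apply, LinearMap.smul_apply, smul_eq_mul]
    ring
  have AA (X Y Z W) : r X Y (S.A (S.A Z)) W = -(algebraMap ℝ R κ * r X Y Z W) := by
    rw [S.A_A_eq, add, smul, smul, ζ0]; ring
  have neg (X Y Z W) : r X Y (-Z) W = -r X Y Z W := by
    rw [← neg_one_smul R, smul]; ring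
  -- Pair symmetry moves A between slots 1 and 2; Bianchi identities with A inserted link the two
  -- pairs of slots.
  have L (X Y Z W) : r (S.A X) Y Z W = r X Y (S.A Z) W := by
    have A1 (X Y Z W) : r (S.A X) Y Z W = r X (S.A Y) Z W := by
      rw [pair, rA, pair]
    refine sub_eq_zero.1 (eq_zero_of_two_mul ?_)
    linear_combination bianchi (S.A X) Y Z W + bianchi X (S.A Y) Z W - bianchi X Y (S.A Z) W
      - bianchi X Y Z (S.A W) + A1 X Y Z W + A1 Z X Y W - A1 Y Z X W
      - rA X Y Z W - rA Y Z X W - rA Z X Y W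
  -- With A parked in slot 1, φ passes from slot 3 to slot 4 without meeting it. Bringing A and φ
  -- back to slot 3 gives φA = -Aφ there, so the value equals its own negative.
  have h0 (X Y Z W) : r X Y (S.A (S.φ Z)) W = 0 := by
    apply eq_zero_of_two_mul
    have h := rφ X Y (S.A Z) W
    rw [S.φ_A, neg] at h
    linear_combination -L X Y (S.φ Z) W + rφ (S.A X) Y Z W - L X Y Z (S.φ W) - h
  refine C.ext_inner fun W => ?_
  -- AφφA = -A², which is κ times the projection onto ker η, and `r` vanishes when its third
  -- argument is ζ.
  have h := h0 X Y (S.φ (S.A Z)) W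
  rw [S.φ_sq, S.g_A_ζ, zero_smul, add_zero, map_neg, neg, AA, neg_neg] at h
  have h1 := eq_zero_of_κ_mul hκ h
  rw [hr] at h1
  linear_combination h1

/-- A = φAφ has the trace of Aφ² = -A, by cyclicity. -/
theorem trace_A [Module.Free R V] [Module.Finite R V] : LinearMap.trace R V S.A = 0 := by
  have h1 : S.A = S.φ * (S.A * S.φ) := by
    ext X; exact (S.φ_anticomm_aux X).symm
  have h2 : S.A * S.φ * S.φ = -S.A := by
    ext X; simp [S.φ_sq, S.A_ζ]
  have h3 := congrArg (LinearMap.trace R V) h1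
  rw [LinearMap.trace_mul_comm, h2, map_neg] at h3
  exact eq_zero_of_two_mul (by linear_combination h3)

/-- The Ricci tensor as a trace. -/
theorem ricci_eq [Module.Free R V] [Module.Finite R V] (hκ : κ ≠ 0) (Y Z : V) :
    LinearMap.trace R V ((C.curv.flip Y).flip Z)
      = algebraMap ℝ R κ * (Module.finrank R V - 1) * (C.g Y S.ζ * C.g Z S.ζ) := by
  -- As an endomorphism in X, the curvature is a combination of rank-one maps, A and the identity,
  -- whose traces are known.
  have h : (C.curv.flip Y).flip Z = (C.g.flip Z ∘ₗ S.A).smulRight (S.A Y)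
      - C.g (S.A Y) Z • S.A + algebraMap ℝ R κ • ((C.g Y S.ζ * C.g Z S.ζ) • LinearMap.id
        - (C.g.flip S.ζ).smulRight (C.g Z S.ζ • Y) + (C.g.flip S.ζ).smulRight (C.g Y Z • S.ζ)
        - (C.g.flip Z).smulRight (C.g Y S.ζ • S.ζ)) := by
    ext X
    simp only [LinearMap.flip_apply, curv_apply, S.K_eq hκ, K₀, LinearMap.add_apply,
      LinearMap.sub_apply, LinearMap.smul_apply, LinearMap.smulRight_apply, LinearMap.comp_apply,
      LinearMap.id_apply]
    module
  rw [h]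
  simp only [map_add, map_sub, map_smul, trace_smulRight, LinearMap.trace_id, S.trace_A, LinearMap.comp_apply,
    LinearMap.flip_apply, smul_eq_mul, S.A_A_eq,
    S.unit_ζ, C.g_symm S.ζ Z]
  ring

/-- The Codazzi equation of the Hessian of `f`, where `Hess f = h`. -/
theorem hessian_codazzi {f : R} {h : V → V → R}
    (H : ∀ X Y, C.D X (C.D Y f) = C.D (C.nabla X Y) f + h X Y)
    (hadd : ∀ X X' Y, h (X - X') Y = h X Y - h X' Y) (X Y Z : V) :
    -C.D (C.K X Y Z) f = (C.D X (h Y Z) - h (C.nabla X Y) Z - h Y (C.nabla X Z))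
      - (C.D Y (h X Z) - h (C.nabla Y X) Z - h X (C.nabla Y Z)) := by
  have e1 := congrArg (C.D X) (H Y Z)
  have e2 := congrArg (C.D Y) (H X Z)
  have e3 := C.D_bracket X Y (C.D Z f)
  rw [H, bracket, hadd] at e3
  rw [map_add, H X (C.nabla Y Z)] at e1
  rw [map_add, H Y (C.nabla X Z)] at e2
  simp only [K, map_sub, Derivation.sub_apply, bracket]
  linear_combination e1 - e2 + e3

/-- There is no quasi-Einstein potential: `Ric + Hess f - s df ⊗ df = μ g` is impossible. -/
theorem not_quasiEinstein [Nontrivial R] [Module.Free R V] [Module.Finite R V]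
    (S : C.Nullity κ) (hκ : κ ≠ 0) (s : ℝ) (μ f : R) (hd : 1 < Module.finrank R V)
    (h : ∀ X Y, LinearMap.trace R V ((C.curv.flip X).flip Y)
      + (C.D X (C.D Y f) - C.D (C.nabla X Y) f) - algebraMap ℝ R s * (C.D X f * C.D Y f)
      = μ * C.g X Y) : False := by
  -- `t` is the coefficient of η ⊗ η in Ric, a real constant and hence killed by all derivations.
  obtain ⟨t, ht⟩ : ∃ t : R, algebraMap ℝ R (κ * (Module.finrank R V - 1)) = t := ⟨_, rfl⟩
  have H (X Y : V) : C.D X (C.D Y f) = C.D (C.nabla X Y) f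
      + (algebraMap ℝ R s * (C.D X f * C.D Y f) + μ * C.g X Y
        - t * (C.g X S.ζ * C.g Y S.ζ)) := by
    have := h X Y
    rw [S.ricci_eq hκ] at this
    rw [← ht, map_mul, map_sub, map_natCast, map_one]
    linear_combination this
  have Dt (X : V) : C.D X t = 0 := by rw [← ht]; exact D_κ _ _
  -- For X = φU and Z = φW, both orthogonal to ζ, K(X, ζ)Z = -κ g(X, Z)ζ. On the Hessian side the
  -- terms quadratic in s cancel, and differentiating -t η ⊗ η contributes -t g(AX, Z).
  have key (U W : V) : t * C.g (S.A (S.φ U)) (S.φ W)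
      = -(C.D S.ζ f * (algebraMap ℝ R κ - algebraMap ℝ R s * μ) + C.D S.ζ μ)
        * C.g (S.φ U) (S.φ W) := by
    have e := hessian_codazzi H (fun X X' Y => by
      simp only [map_sub, Derivation.sub_apply, LinearMap.sub_apply]; ring) (S.φ U) S.ζ (S.φ W)
    obtain ⟨X, hX⟩ : ∃ X, S.φ U = X := ⟨_, rfl⟩
    obtain ⟨Z, hZ⟩ : ∃ Z, S.φ W = Z := ⟨_, rfl⟩
    have eX : C.g X S.ζ = 0 := by rw [← hX, S.g_φ_ζ]
    have eZ : C.g Z S.ζ = 0 := by rw [← hZ, S.g_φ_ζ]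
    have eN : C.g (C.nabla X Z) S.ζ = -C.g (S.A X) Z := by
      have := S.D_η X Z
      rw [eZ, map_zero, C.g_symm Z] at this
      linear_combination -this
    rw [hX, hZ, S.K_eq hκ, K₀] at e
    rw [hX, hZ]
    simp only [map_add, map_sub, map_smul, Derivation.leibniz, C.compat, Dt, D_κ, eN, S.unit_ζ,
      S.A_ζ, H, eX, eZ, S.nabla_ζ, Derivation.add_apply, Derivation.sub_apply,
      Derivation.smul_apply, smul_eq_mul, C.g_symm S.ζ, S.g_A_ζ, map_zero,
      LinearMap.zero_apply, Derivation.coe_zero, Pi.zero_apply] at e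
    linear_combination e
  -- Comparing `key` at (U, W) and at (φU, φW): the right sides agree, while the left sides are
  -- opposite.
  have tA (U : V) : t • S.A U = 0 := by
    refine C.g_nondeg _ fun W => eq_zero_of_two_mul ?_
    have e1 := key U W
    have e2 := key (S.φ U) (S.φ W)
    rw [S.g_φ_φ (S.φ U), S.g_φ_ζ, S.φ_sq, S.φ_sq] at e2
    have e3 : C.g (S.A (S.φ U)) (S.φ W) = -C.g (S.A U) W := by
      rw [← neg_neg (S.A (S.φ U)), ← S.φ_A, map_neg, LinearMap.neg_apply, S.g_φ_φ, S.g_A_ζ]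
      ring
    simp only [map_add, map_neg, map_smul, S.A_ζ, S.g_A_ζ, LinearMap.neg_apply, smul_zero,
      add_zero, smul_eq_mul, neg_neg] at e2
    rw [e3] at e1
    simp only [map_smul, LinearMap.smul_apply, smul_eq_mul]
    linear_combination e2 - e1
  -- Evaluating `tA` at AU brings in A² = -κ(I - η ⊗ ζ), and κ cancels.
  have tI (U : V) : t • (U - C.g U S.ζ • S.ζ) = 0 := by
    have e := tA (S.A U)
    rw [S.A_A_eq] at e
    refine C.g_nondeg _ fun W => eq_zero_of_κ_mul hκ ?_
    have e1 := congrArg (fun v => C.g v W) e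
    simp only [map_add, map_sub, map_smul, LinearMap.add_apply, LinearMap.sub_apply,
      LinearMap.smul_apply, smul_eq_mul, map_zero, LinearMap.zero_apply] at e1 ⊢
    linear_combination -e1
  have htr : t * (Module.finrank R V - 1) = 0 := by
    have e : t • (LinearMap.id - (C.g.flip S.ζ).smulRight S.ζ) = 0 := by
      ext U; exact tI U
    have e1 := congrArg (LinearMap.trace R V) e
    rw [map_smul, map_sub, LinearMap.trace_id, trace_smulRight, map_zero] at e1
    simpa [S.unit_ζ] using e1
  have h1 : algebraMap ℝ R (κ * (Module.finrank R V - 1) * (Module.finrank R V - 1)) = 0 := by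
    rw [map_mul, ht, map_sub, map_natCast, map_one, htr]
  have h2 : (κ * (Module.finrank R V - 1) * (Module.finrank R V - 1) : ℝ) = 0 :=
    (map_eq_zero (algebraMap ℝ R)).1 h1
  have h3 : (1 : ℝ) < Module.finrank R V := by exact_mod_cast hd
  have h4 : (Module.finrank R V - 1 : ℝ) ≠ 0 := by linarith
  simp [hκ, h4] at h2

/-- Version of `not_quasiEinstein` for an equation that is given pointwise. -/
theorem not_quasiEinstein_of_eval [Nontrivial R] [Module.Free R V] [Module.Finite R V]
    (S : C.Nullity κ) (hκ : κ ≠ 0) {U : Type*} (ev : U → R →ₐ[ℝ] ℝ)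
    (hev : ∀ a b, (∀ y, ev y a = ev y b) → a = b) (s : ℝ) (μ : U → ℝ) (f : R)
    (hd : 1 < Module.finrank R V)
    (h : ∀ y X Y, ev y (LinearMap.trace R V ((C.curv.flip X).flip Y))
      + ev y (C.D X (C.D Y f) - C.D (C.nabla X Y) f) - s * (ev y (C.D X f) * ev y (C.D Y f))
      = μ y * ev y (C.g X Y)) : False := by
  have h' (y X Y) : ev y (LinearMap.trace R V ((C.curv.flip X).flip Y)
      + (C.D X (C.D Y f) - C.D (C.nabla X Y) f) - algebraMap ℝ R s * (C.D X f * C.D Y f))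
      = μ y * ev y (C.g X Y) := by
    rw [← h, map_sub, map_add, map_mul, map_mul, AlgHom.commutes]; rfl
  -- The coefficient μ is given only pointwise. Since g(ζ, ζ) = 1, the left side at (ζ, ζ) realises
  -- it as an element of R.
  obtain ⟨ν, hν⟩ : ∃ ν, ν = LinearMap.trace R V ((C.curv.flip S.ζ).flip S.ζ)
      + (C.D S.ζ (C.D S.ζ f) - C.D (C.nabla S.ζ S.ζ) f)
      - algebraMap ℝ R s * (C.D S.ζ f * C.D S.ζ f) := ⟨_, rfl⟩
  refine S.not_quasiEinstein hκ s ν f hd fun X Y => hev _ _ fun y => ?_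
  rw [hν, map_mul, h', h', S.unit_ζ, map_one, mul_one]

end Nullity
end LeviCivitaCalculus
end AlmostCoKahler

/-! ### The Levi-Civita calculus of a metric matrix in coordinates. -/

namespace AlmostCoKahler

/-- Commuting derivations `∂ᵢ` of a ring of functions with coordinate functions `xⁱ`. -/
structure CoordSystem (ι R : Type*) [DecidableEq ι] [CommRing R] [Algebra ℝ R] where
  /-- the partial derivatives -/
  pd : ι → Derivation ℝ R R
  /-- the coordinate functions -/
  x : ι → R
  pd_comm : ∀ i j f, pd i (pd j f) = pd j (pd i f)
  pd_x : ∀ i j, pd i (x j) = if i = j then 1 else 0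

namespace CoordSystem

variable {ι R : Type*} [DecidableEq ι] [Fintype ι] [CommRing R] [Algebra ℝ R]
  (P : CoordSystem ι R)

/-- The derivative along a vector field. -/
def dir : (ι → R) →ₗ[R] Derivation ℝ R R := Fintype.linearCombination R P.pd

theorem dir_apply (X : ι → R) (f : R) : P.dir X f = ∑ i, X i * P.pd i f := by
  rw [dir, Fintype.linearCombination_apply, ← Derivation.coeFnAddMonoidHom_apply, map_sum,
    Finset.sum_apply]
  simp

theorem dir_single (i : ι) (f : R) : P.dir (Pi.single i 1) f = P.pd i f := by
  simp [dir]

/-- The Christoffel symbols of the metric `G`. -/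
noncomputable def chr (G : Matrix ι ι R) (k i j : ι) : R :=
  algebraMap ℝ R (1 / 2) * ∑ l, G⁻¹ k l * (P.pd i (G j l) + P.pd j (G i l) - P.pd l (G i j))

variable {G : Matrix ι ι R}

theorem chr_symm (hG : ∀ i j, G i j = G j i) (k i j : ι) : P.chr G k i j = P.chr G k j i := by
  unfold chr
  congr 1
  refine Finset.sum_congr rfl fun l _ => ?_
  rw [hG i j]; ring

theorem chr_lower (hG : ∀ i j, G i j = G j i) (hdet : IsUnit G.det) (i j m : ι) :
    ∑ k, P.chr G k i j * G k m
      = algebraMap ℝ R (1 / 2) * (P.pd i (G j m) + P.pd j (G i m) - P.pd m (G i j)) := by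
  have h1 (l : ι) : ∑ k, G⁻¹ k l * G k m = if m = l then 1 else 0 := by
    have := congrFun (congrFun (Matrix.mul_nonsing_inv G hdet) m) l
    rw [Matrix.mul_apply, Matrix.one_apply] at this
    rw [← this]
    exact Finset.sum_congr rfl fun k _ => by rw [hG k m]; ring
  simp only [chr, mul_assoc, Finset.sum_mul, ← Finset.mul_sum]
  congr 1
  rw [Finset.sum_comm]
  have h2 (l : ι) : ∑ k, G⁻¹ k l * ((P.pd i (G j l) + P.pd j (G i l) - P.pd l (G i j)) * G k m)
      = (if m = l then 1 else 0) * (P.pd i (G j l) + P.pd j (G i l) - P.pd l (G i j)) := by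
    rw [← h1, Finset.sum_mul]
    exact Finset.sum_congr rfl fun k _ => by ring
  simp [h2]

/-- Adding two lowered Christoffel symbols with i and j exchanged cancels all but the derivative of
the metric along a. -/
theorem chr_metric (hG : ∀ i j, G i j = G j i) (hdet : IsUnit G.det) (a i j : ι) :
    P.pd a (G i j) = ∑ k, P.chr G k a i * G k j + ∑ k, P.chr G k a j * G i k := by
  have e : ∑ k, P.chr G k a j * G i k = ∑ k, P.chr G k a j * G k i :=
    Finset.sum_congr rfl fun k _ => by rw [hG]
  have h1 : algebraMap ℝ R (1 / 2) * 2 = 1 := by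
    rw [← map_ofNat (algebraMap ℝ R) 2, ← map_mul]; norm_num
  rw [e, P.chr_lower hG hdet, P.chr_lower hG hdet, hG j i]
  linear_combination -P.pd a (G i j) * h1

/-- The connection with the Christoffel symbols of `G`. -/
noncomputable def nabla (G : Matrix ι ι R) (X Y : ι → R) (k : ι) : R :=
  P.dir X (Y k) + ∑ i, ∑ j, P.chr G k i j * (X i * Y j)

/-- The bilinear form with matrix `G`. -/
def form (G : Matrix ι ι R) : (ι → R) →ₗ[R] (ι → R) →ₗ[R] R := Matrix.toLinearMap₂' R G

omit [Algebra ℝ R] in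
theorem form_apply (X Y : ι → R) : form G X Y = ∑ i, ∑ j, X i * Y j * G i j := by
  simp [form, Matrix.toLinearMap₂'_apply, mul_assoc]

theorem nabla_compat (hG : ∀ i j, G i j = G j i) (hdet : IsUnit G.det) (X Y Z : ι → R) :
    P.dir X (form G Y Z) = form G (P.nabla G X Y) Z + form G Y (P.nabla G X Z) := by
  have h (i j : ι) : P.dir X (G i j) = ∑ k, (∑ a, P.chr G k a i * X a) * G k j
      + ∑ k, (∑ a, P.chr G k a j * X a) * G i k := by
    simp only [P.dir_apply, P.chr_metric hG hdet, mul_add, Finset.sum_add_distrib, Finset.sum_mul,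
      Finset.mul_sum]
    congr 1
    · rw [Finset.sum_comm]
      exact Finset.sum_congr rfl fun _ _ => Finset.sum_congr rfl fun _ _ => by ring
    · rw [Finset.sum_comm]
      exact Finset.sum_congr rfl fun _ _ => Finset.sum_congr rfl fun _ _ => by ring
  have n (Y : ι → R) (k : ι) :
      P.nabla G X Y k = P.dir X (Y k) + ∑ j, (∑ a, P.chr G k a j * X a) * Y j := by
    rw [nabla, Finset.sum_comm]
    simp only [Finset.sum_mul, mul_assoc]
  -- γ is the connection matrix along X; keeping it opaque reduces compatibility to reindexing
  -- triple sums.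
  obtain ⟨γ, hγ⟩ : ∃ γ : ι → ι → R, ∀ k j, ∑ a, P.chr G k a j * X a = γ k j :=
    ⟨_, fun _ _ => rfl⟩
  simp only [hγ] at h n
  simp only [form_apply, map_sum, Derivation.leibniz, n, h, smul_eq_mul, add_mul, mul_add,
    Finset.sum_add_distrib, Finset.sum_mul, Finset.mul_sum]
  have e1 : ∑ i, ∑ j, ∑ k, Y i * Z j * (γ k i * G k j) = ∑ i, ∑ j, ∑ k, γ i k * Y k * Z j * G i j := by
    rw [Finset.sum_comm]
    conv_rhs => rw [Finset.sum_comm]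
    refine Finset.sum_congr rfl fun j _ => ?_
    rw [Finset.sum_comm]
    exact Finset.sum_congr rfl fun _ _ => Finset.sum_congr rfl fun _ _ => by ring
  have e2 : ∑ i, ∑ j, ∑ k, Y i * Z j * (γ k j * G i k) = ∑ i, ∑ j, ∑ k, Y i * (γ j k * Z k) * G i j := by
    refine Finset.sum_congr rfl fun j _ => ?_
    rw [Finset.sum_comm]
    exact Finset.sum_congr rfl fun _ _ => Finset.sum_congr rfl fun _ _ => by ring
  have e3 : ∑ i, ∑ j, G i j * (Y i * P.dir X (Z j)) = ∑ i, ∑ j, Y i * P.dir X (Z j) * G i j :=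
    Finset.sum_congr rfl fun _ _ => Finset.sum_congr rfl fun _ _ => by ring
  have e4 : ∑ i, ∑ j, G i j * (Z j * P.dir X (Y i)) = ∑ i, ∑ j, P.dir X (Y i) * Z j * G i j :=
    Finset.sum_congr rfl fun _ _ => Finset.sum_congr rfl fun _ _ => by ring
  rw [e1, e2, e3, e4]; ring

theorem dir_dir (X Y : ι → R) (f : R) : P.dir X (P.dir Y f)
    = P.dir (fun k => P.dir X (Y k)) f + ∑ i, ∑ j, X i * Y j * P.pd i (P.pd j f) := by
  simp only [P.dir_apply, map_sum, Derivation.leibniz, smul_eq_mul, mul_add, Finset.mul_sum,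
    Finset.sum_add_distrib, Finset.sum_mul]
  rw [add_comm]
  congr 1
  · rw [Finset.sum_comm]
    exact Finset.sum_congr rfl fun _ _ => Finset.sum_congr rfl fun _ _ => by ring
  · exact Finset.sum_congr rfl fun _ _ => Finset.sum_congr rfl fun _ _ => by ring

theorem nabla_eq (X Y : ι → R) : P.nabla G X Y
    = (fun k => P.dir X (Y k)) + fun k => ∑ i, ∑ j, P.chr G k i j * (X i * Y j) := rfl

/-- The Levi-Civita calculus of the metric `G` in a coordinate system. -/
noncomputable def calculus (G : Matrix ι ι R) (hG : ∀ i j, G i j = G j i) (hdet : IsUnit G.det) :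
    LeviCivitaCalculus R (ι → R) where
  D := P.dir
  nabla := P.nabla G
  g := form G
  nabla_add_left X Y Z := by
    ext k
    simp only [nabla, Pi.add_apply, map_add, Derivation.add_apply, add_mul, mul_add,
      Finset.sum_add_distrib]
    ring
  nabla_smul_left f X Z := by
    ext k
    simp only [nabla, Pi.smul_apply, map_smul, Derivation.smul_apply, smul_eq_mul, mul_add,
      Finset.mul_sum]
    congr 1
    exact Finset.sum_congr rfl fun _ _ => Finset.sum_congr rfl fun _ _ => by ring
  nabla_add_right X Y Z := by
    ext k
    simp only [nabla, Pi.add_apply, map_add, mul_add, Finset.sum_add_distrib]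
    ring
  nabla_smul_right X f Y := by
    ext k
    simp only [nabla, Pi.add_apply, Pi.smul_apply, Derivation.leibniz, smul_eq_mul, mul_add,
      Finset.mul_sum]
    have : ∑ i, ∑ j, P.chr G k i j * (X i * (f * Y j))
        = ∑ i, ∑ j, f * (P.chr G k i j * (X i * Y j)) :=
      Finset.sum_congr rfl fun _ _ => Finset.sum_congr rfl fun _ _ => by ring
    rw [this]; ring
  g_symm X Y := by
    rw [form_apply, form_apply, Finset.sum_comm]
    exact Finset.sum_congr rfl fun i _ => Finset.sum_congr rfl fun j _ => by rw [hG i j]; ring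
  g_nondeg X h := by
    have h1 : Matrix.vecMul X G = 0 := by
      ext j
      have := h (Pi.single j 1)
      simpa [form_apply, Matrix.vecMul, dotProduct, Pi.single_apply] using this
    rw [← Matrix.vecMul_one X, ← Matrix.mul_nonsing_inv G hdet, ← Matrix.vecMul_vecMul, h1,
      Matrix.zero_vecMul]
  compat := P.nabla_compat hG hdet
  torsion X Y f := by
    rw [P.dir_dir, P.dir_dir, P.nabla_eq, P.nabla_eq]
    have e1 : ∑ i, ∑ j, Y i * X j * P.pd i (P.pd j f) = ∑ i, ∑ j, X i * Y j * P.pd i (P.pd j f) := by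
      rw [Finset.sum_comm]
      exact Finset.sum_congr rfl fun i _ => Finset.sum_congr rfl fun j _ => by
        rw [P.pd_comm]; ring
    have e2 : (fun k => ∑ i, ∑ j, P.chr G k i j * (Y i * X j))
        = fun k => ∑ i, ∑ j, P.chr G k i j * (X i * Y j) := by
      ext k
      rw [Finset.sum_comm]
      exact Finset.sum_congr rfl fun i _ => Finset.sum_congr rfl fun j _ => by
        rw [P.chr_symm hG]; ring
    rw [e1, e2]
    simp only [map_add, map_sub, Derivation.add_apply, Derivation.sub_apply]
    ring
  faithful X h := by
    ext k
    simpa [P.dir_apply, P.pd_x] using h (P.x k)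

variable (hG : ∀ i j, G i j = G j i) (hdet : IsUnit G.det)

theorem nabla_single (i : ι) (Y : ι → R) (l : ι) :
    P.nabla G (Pi.single i 1) Y l = P.pd i (Y l) + ∑ s, P.chr G l i s * Y s := by
  rw [nabla, dir_single]
  simp [Pi.single_apply]

theorem nabla_single_single (i j : ι) :
    P.nabla G (Pi.single i 1) (Pi.single j 1) = fun k => P.chr G k i j := by
  ext l
  rw [nabla_single]
  rcases eq_or_ne l j with rfl | h
  · simp [Pi.single_apply]
  · simp [Pi.single_apply, h]

theorem K_single (i j k l : ι) :
    (P.calculus G hG hdet).K (Pi.single i 1) (Pi.single j 1) (Pi.single k 1) l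
      = P.pd i (P.chr G l j k) - P.pd j (P.chr G l i k)
        + ∑ s, (P.chr G l i s * P.chr G s j k - P.chr G l j s * P.chr G s i k) := by
  have h0 : (P.calculus G hG hdet).bracket (Pi.single i 1) (Pi.single j 1) = 0 := by
    change P.nabla G _ _ - P.nabla G _ _ = 0
    rw [nabla_single_single, nabla_single_single]
    ext k
    simp [P.chr_symm hG k i j]
  have hz : (P.calculus G hG hdet).nabla 0 (Pi.single k 1) = 0 := by
    simpa using (P.calculus G hG hdet).nabla_smul_left 0 0 (Pi.single k 1)
  rw [LeviCivitaCalculus.K, h0, hz]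
  change P.nabla G _ (P.nabla G _ _) l - P.nabla G _ (P.nabla G _ _) l - 0 = _
  rw [nabla_single_single, nabla_single_single, nabla_single, nabla_single,
    Finset.sum_sub_distrib]
  ring

/-- Tensoriality, packaged in `curv`, reduces the formula to coordinate fields, whose brackets
vanish. -/
theorem K_apply (X Y Z : ι → R) (l : ι) :
    (P.calculus G hG hdet).K X Y Z l = ∑ i, ∑ j, ∑ k, X i * Y j * Z k *
      (P.pd i (P.chr G l j k) - P.pd j (P.chr G l i k)
        + ∑ s, (P.chr G l i s * P.chr G s j k - P.chr G l j s * P.chr G s i k)) := by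
  rw [← LeviCivitaCalculus.curv_apply]
  conv_lhs => rw [pi_eq_sum_univ' X, pi_eq_sum_univ' Y, pi_eq_sum_univ' Z]
  simp only [map_sum, LinearMap.sum_apply, map_smul, LinearMap.smul_apply, Finset.sum_apply,
    Pi.smul_apply, smul_eq_mul, LeviCivitaCalculus.curv_apply, P.K_single hG hdet, Finset.smul_sum,
    mul_assoc]
  rw [Finset.sum_comm]
  conv_rhs => rw [Finset.sum_comm]
  refine Finset.sum_congr rfl fun j _ => ?_
  rw [Finset.sum_comm]
  exact Finset.sum_congr rfl fun _ _ => Finset.sum_congr rfl fun _ _ => by ring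

theorem trace_curv (Y Z : ι → R) :
    LinearMap.trace R (ι → R) (((P.calculus G hG hdet).curv.flip Y).flip Z)
      = ∑ i, (P.calculus G hG hdet).K (Pi.single i 1) Y Z i := by
  rw [LinearMap.trace_eq_matrix_trace R (Pi.basisFun R ι), Matrix.trace]
  simp

/-- The Hessian in coordinates. -/
theorem hessian_eq (X Y : ι → R) (f : R) : P.dir X (P.dir Y f) - P.dir (P.nabla G X Y) f
    = ∑ i, ∑ j, X i * Y j * (P.pd i (P.pd j f) - ∑ k, P.chr G k i j * P.pd k f) := by
  rw [P.dir_dir, P.nabla_eq, map_add, Derivation.add_apply, P.dir_apply (fun k => ∑ i, _)]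
  simp only [mul_sub, Finset.sum_sub_distrib, Finset.sum_mul, Finset.mul_sum]
  have : ∑ k, ∑ i, ∑ j, P.chr G k i j * (X i * Y j) * P.pd k f
      = ∑ i, ∑ j, ∑ k, X i * Y j * (P.chr G k i j * P.pd k f) := by
    rw [Finset.sum_comm]
    refine Finset.sum_congr rfl fun i _ => ?_
    rw [Finset.sum_comm]
    exact Finset.sum_congr rfl fun _ _ => Finset.sum_congr rfl fun _ _ => by ring
  rw [this]; ring

omit [Algebra ℝ R] in
/-- A property of vector fields that is closed under linear combinations holds for all of them
if it holds for the coordinate fields. -/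
theorem induction_single {p : (ι → R) → Prop} (add : ∀ X Y, p X → p Y → p (X + Y))
    (smul : ∀ (f : R) X, p X → p (f • X)) (single : ∀ i, p (Pi.single i 1)) [Nonempty ι]
    (X : ι → R) : p X := by
  refine Submodule.span_induction (p := fun X _ => p X) ?_ ?_ (fun X Y _ _ => add X Y)
    (fun f X _ => smul f X) ((Pi.basisFun R ι).mem_span X)
  · rintro _ ⟨i, rfl⟩
    simpa using single i
  · simpa using smul 0 _ (single (Classical.arbitrary ι))

end CoordSystem

namespace CoordSystem

variable {ι R : Type*} [DecidableEq ι] [Fintype ι] [Nonempty ι] [CommRing R] [Algebra ℝ R]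
  (P : CoordSystem ι R) {G : Matrix ι ι R} (hG : ∀ i j, G i j = G j i) (hdet : IsUnit G.det)

omit [Nonempty ι] in
theorem D_single (i : ι) (f : R) : (P.calculus G hG hdet).D (Pi.single i 1) f = P.pd i f :=
  P.dir_single i f

omit [Nonempty ι] in
theorem nabla_single_symm (i j : ι) :
    (P.calculus G hG hdet).nabla (Pi.single i 1) (Pi.single j 1)
      = (P.calculus G hG hdet).nabla (Pi.single j 1) (Pi.single i 1) := by
  change P.nabla G _ _ = P.nabla G _ _
  rw [P.nabla_single_single, P.nabla_single_single]
  ext1 k; exact P.chr_symm hG k i j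

/-- Closedness of the 1-form dual to `Z` in terms of the connection. -/
theorem closed_one_form {Z : ι → R} (h : ∀ i j,
    P.pd i ((P.calculus G hG hdet).g Z (Pi.single j 1))
      = P.pd j ((P.calculus G hG hdet).g Z (Pi.single i 1))) (X Y : ι → R) :
    (P.calculus G hG hdet).g ((P.calculus G hG hdet).nabla X Z) Y
      = (P.calculus G hG hdet).g ((P.calculus G hG hdet).nabla Y Z) X := by
  have hs := P.nabla_single_symm hG hdet
  simp only [← P.D_single hG hdet] at h
  generalize P.calculus G hG hdet = C at h hs ⊢
  -- Both sides are tensorial in X and Y. On coordinate fields the extra terms cancel because ∇_i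
  -- ∂_j is symmetric.
  induction X using induction_single with
  | add X X' hX hX' => simp only [C.nabla_add_left, map_add, LinearMap.add_apply, hX, hX']
  | smul f X hX => simp only [C.nabla_smul_left, map_smul, LinearMap.smul_apply, hX]
  | single i =>
    induction Y using induction_single with
    | add X X' hX hX' => simp only [C.nabla_add_left, map_add, LinearMap.add_apply, hX, hX']
    | smul f X hX => simp only [C.nabla_smul_left, map_smul, LinearMap.smul_apply, hX]
    | single j =>
      have h1 := h i j
      rw [C.compat, C.compat, hs i j] at h1
      linear_combination h1

/-- Closedness of the 2-form `g(X, F Y)` in terms of the connection. -/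
theorem closed_two_form {F : (ι → R) →ₗ[R] (ι → R)}
    (skew : ∀ X Y, (P.calculus G hG hdet).g (F X) Y = -(P.calculus G hG hdet).g X (F Y))
    (h : ∀ i j k, P.pd i ((P.calculus G hG hdet).g (Pi.single j 1) (F (Pi.single k 1)))
      + P.pd j ((P.calculus G hG hdet).g (Pi.single k 1) (F (Pi.single i 1)))
      + P.pd k ((P.calculus G hG hdet).g (Pi.single i 1) (F (Pi.single j 1))) = 0)
    (X Y Z : ι → R) :
    (P.calculus G hG hdet).g ((P.calculus G hG hdet).nabla X (F Y)
        - F ((P.calculus G hG hdet).nabla X Y)) Z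
      + (P.calculus G hG hdet).g ((P.calculus G hG hdet).nabla Y (F Z)
        - F ((P.calculus G hG hdet).nabla Y Z)) X
      + (P.calculus G hG hdet).g ((P.calculus G hG hdet).nabla Z (F X)
        - F ((P.calculus G hG hdet).nabla Z X)) Y = 0 := by
  have hs := P.nabla_single_symm hG hdet
  simp only [← P.D_single hG hdet] at h
  generalize P.calculus G hG hdet = C at h hs skew ⊢
  obtain ⟨B, hB⟩ : ∃ B : (ι → R) → (ι → R) → (ι → R), ∀ X Y,
      B X Y = C.nabla X (F Y) - F (C.nabla X Y) :=
    ⟨_, fun _ _ => rfl⟩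
  have Ba1 (X X' Y) : B (X + X') Y = B X Y + B X' Y := by
    simp only [hB]; exact LeviCivitaCalculus.Nullity.dT_add_left F X X' Y
  have Bs1 (f : R) (X Y) : B (f • X) Y = f • B X Y := by
    simp only [hB]; exact LeviCivitaCalculus.Nullity.dT_smul_left F f X Y
  have Ba2 (X Y Y') : B X (Y + Y') = B X Y + B X Y' := by
    simp only [hB]; exact LeviCivitaCalculus.Nullity.dT_add F X Y Y'
  have Bs2 (f : R) (X Y) : B X (f • Y) = f • B X Y := by
    simp only [hB]; exact LeviCivitaCalculus.Nullity.dT_smul F X f Y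
  simp only [← hB]
  induction X using induction_single with
  | add X X' h h' =>
    simp only [Ba1, Ba2, map_add, LinearMap.add_apply]; linear_combination h + h'
  | smul f X h =>
    simp only [Bs1, Bs2, map_smul, LinearMap.smul_apply, smul_eq_mul]; linear_combination f * h
  | single i =>
    induction Y using induction_single with
    | add X X' h h' =>
      simp only [Ba1, Ba2, map_add, LinearMap.add_apply]; linear_combination h + h'
    | smul f X h =>
      simp only [Bs1, Bs2, map_smul, LinearMap.smul_apply, smul_eq_mul]
      linear_combination f * h
    | single j =>
      induction Z using induction_single with
      | add X X' h h' =>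
        simp only [Ba1, Ba2, map_add, LinearMap.add_apply]; linear_combination h + h'
      | smul f X h =>
        simp only [Bs1, Bs2, map_smul, LinearMap.smul_apply, smul_eq_mul]
        linear_combination f * h
      | single k =>
        -- The order i, k, j matches Φ(X, Y) = g(X, FY): the derivative along ∂_i of g(∂_k, F∂_j)
        -- contains g((∇_i F)∂_j, ∂_k).
        have h1 := h i k j
        rw [C.compat, C.compat, C.compat, hs i k, hs k j, hs j i] at h1
        simp only [hB, map_sub, LinearMap.sub_apply, skew (C.nabla _ _)]
        linear_combination h1
          + C.g_symm (C.nabla (Pi.single i 1) (F (Pi.single j 1))) (Pi.single k 1)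
          + C.g_symm (C.nabla (Pi.single j 1) (F (Pi.single k 1))) (Pi.single i 1)
          + C.g_symm (C.nabla (Pi.single k 1) (F (Pi.single i 1))) (Pi.single j 1)

end CoordSystem
end AlmostCoKahler

/-! ### The ring of smooth functions on an open subset of ℝᵈ. -/

namespace AlmostCoKahler

variable {d : ℕ}

/-- The ring of smooth functions on an open set of `ℝᵈ`. -/
def SmoothFun (U : TopologicalSpace.Opens (EuclideanSpace ℝ (Fin d))) : Subalgebra ℝ (U → ℝ) where
  carrier := {f | ∃ F : EuclideanSpace ℝ (Fin d) → ℝ, ContDiffOn ℝ ∞ F U ∧ ∀ x : U, F x = f x}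
  mul_mem' := by
    rintro f g ⟨F, hF, hf⟩ ⟨G, hG, hg⟩
    exact ⟨F * G, hF.mul hG, fun x => by simp [hf, hg]⟩
  add_mem' := by
    rintro f g ⟨F, hF, hf⟩ ⟨G, hG, hg⟩
    exact ⟨F + G, hF.add hG, fun x => by simp [hf, hg]⟩
  algebraMap_mem' r := ⟨fun _ => r, contDiffOn_const, fun _ => rfl⟩

namespace SmoothFun

variable {U : TopologicalSpace.Opens (EuclideanSpace ℝ (Fin d))}

/-- The restriction to `U` of a function that is smooth on `U`. -/
def mk (F : EuclideanSpace ℝ (Fin d) → ℝ) (hF : ContDiffOn ℝ ∞ F U) : SmoothFun U :=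
  ⟨fun x => F x, F, hF, fun _ => rfl⟩

/-- A smooth extension of an element of the ring of smooth functions. -/
noncomputable def out (f : SmoothFun U) : EuclideanSpace ℝ (Fin d) → ℝ := f.2.choose

theorem contDiffOn_out (f : SmoothFun U) : ContDiffOn ℝ ∞ (out f) U := f.2.choose_spec.1

theorem out_apply (f : SmoothFun U) (x : U) : out f x = f.1 x := f.2.choose_spec.2 x

theorem fderiv_congr {F G : EuclideanSpace ℝ (Fin d) → ℝ} (h : ∀ x : U, F x = G x) (x : U) :
    fderiv ℝ F x = fderiv ℝ G x :=
  Filter.EventuallyEq.fderiv_eq <| by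
    filter_upwards [U.isOpen.mem_nhds x.2] with y hy using h ⟨y, hy⟩

theorem differentiableAt {F : EuclideanSpace ℝ (Fin d) → ℝ} (hF : ContDiffOn ℝ ∞ F U) (x : U) :
    DifferentiableAt ℝ F x :=
  (hF.contDiffAt (U.isOpen.mem_nhds x.2)).differentiableAt (by simp)

theorem contDiffOn_fderiv {F : EuclideanSpace ℝ (Fin d) → ℝ} (hF : ContDiffOn ℝ ∞ F U)
    (v : EuclideanSpace ℝ (Fin d)) : ContDiffOn ℝ ∞ (fun x => fderiv ℝ F x v) U :=
  (hF.fderiv_of_isOpen U.isOpen (by simp)).clm_apply contDiffOn_const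

/-- The partial derivatives on the ring of smooth functions. -/
noncomputable def pd (i : Fin d) : Derivation ℝ (SmoothFun U) (SmoothFun U) :=
  Derivation.mk'
    { toFun := fun f => mk _ (contDiffOn_fderiv (contDiffOn_out f) (EuclideanSpace.single i (1 : ℝ)))
      map_add' := fun f g => by
        ext x
        change fderiv ℝ (out (f + g)) x _ = fderiv ℝ (out f) x _ + fderiv ℝ (out g) x _
        rw [fderiv_congr (G := (out f) + (out g)) (fun x => by simp [out_apply]),
          fderiv_add (differentiableAt (contDiffOn_out f) x) (differentiableAt (contDiffOn_out g) x)]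
        rfl
      map_smul' := fun r f => by
        ext x
        change fderiv ℝ (out (r • f)) x _ = r * fderiv ℝ (out f) x _
        rw [fderiv_congr (G := r • (out f)) (fun x => by simp [out_apply]),
          fderiv_const_smul (differentiableAt (contDiffOn_out f) x)]
        rfl }
    fun f g => by
      ext x
      change fderiv ℝ (out (f * g)) x _ = f.1 x * fderiv ℝ (out g) x _ + g.1 x * fderiv ℝ (out f) x _
      rw [fderiv_congr (G := (out f) * (out g)) (fun x => by simp [out_apply]),
        fderiv_mul (differentiableAt (contDiffOn_out f) x) (differentiableAt (contDiffOn_out g) x)]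
      simp [out_apply]

/-- `pd` is defined by a chosen extension; since U is open, any extension has the same derivative at
its points. -/
theorem pd_apply (i : Fin d) (f : SmoothFun U) (F : EuclideanSpace ℝ (Fin d) → ℝ)
    (h : ∀ x : U, F x = f.1 x) (x : U) :
    (pd i f).1 x = fderiv ℝ F x (EuclideanSpace.single i (1 : ℝ)) := by
  change fderiv ℝ (out f) x _ = _
  rw [fderiv_congr (G := F) fun x => by rw [h, out_apply]]

/-- The standard coordinate system on the ring of smooth functions. -/
noncomputable def coordSystem (U : TopologicalSpace.Opens (EuclideanSpace ℝ (Fin d))) :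
    CoordSystem (Fin d) (SmoothFun U) where
  pd := pd
  x k := mk (fun y => y k) (by fun_prop)
  pd_comm i j f := by
    ext x
    have e (i j : Fin d) : (pd i (pd j f)).1 x = fderiv ℝ (fderiv ℝ (out f)) x
        (EuclideanSpace.single i (1 : ℝ)) (EuclideanSpace.single j (1 : ℝ)) := by
      rw [pd_apply i (pd j f) (fun y => fderiv ℝ (out f) y (EuclideanSpace.single j (1 : ℝ)))
        fun y => rfl]
      have hd : DifferentiableAt ℝ (fderiv ℝ (out f)) x :=
        (((contDiffOn_out f).fderiv_of_isOpen (m := ∞) U.isOpen (by simp)).contDiffAt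
          (U.isOpen.mem_nhds x.2)).differentiableAt (by simp)
      rw [fderiv_clm_apply hd (differentiableAt_const _)]
      simp
    rw [e, e]
    exact (((contDiffOn_out f).contDiffAt (U.isOpen.mem_nhds x.2)).isSymmSndFDerivAt
      (by simpa using WithTop.coe_le_coe.2 (le_top : (2 : ℕ∞) ≤ ⊤))) _ _
  pd_x i j := by
    ext x
    rw [pd_apply i _ (fun y => y j) fun y => rfl]
    have : fderiv ℝ (fun y : EuclideanSpace ℝ (Fin d) => y j) x = EuclideanSpace.proj j :=
      (EuclideanSpace.proj (𝕜 := ℝ) j).fderiv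
    rw [this]
    rcases eq_or_ne i j with rfl | h
    · simp
    · simp [h, h.symm]

/-- Evaluation at a point. -/
def eval (x : U) : SmoothFun U →ₐ[ℝ] ℝ :=
  (Pi.evalAlgHom ℝ (fun _ : U => ℝ) x).comp (SmoothFun U).val

theorem isUnit_of_eval_ne_zero (f : SmoothFun U) (h : ∀ x, eval x f ≠ 0) : IsUnit f := by
  have h1 : ContDiffOn ℝ ∞ (fun x => ((out f) x)⁻¹) U :=
    (contDiffOn_out f).inv fun x hx => by rw [out_apply f ⟨x, hx⟩]; exact h ⟨x, hx⟩
  refine IsUnit.of_mul_eq_one (mk _ h1) ?_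
  ext x
  change f.1 x * ((out f) x)⁻¹ = 1
  rw [out_apply]
  exact mul_inv_cancel₀ (h x)

theorem ext_eval {f g : SmoothFun U} (h : ∀ x, eval x f = eval x g) : f = g :=
  Subtype.ext (funext h)

theorem eval_inv {ι : Type*} [Fintype ι] [DecidableEq ι] {G : Matrix ι ι (SmoothFun U)}
    (hG : IsUnit G.det) (x : U) :
    (G.map (eval x))⁻¹ = G⁻¹.map (eval x) := by
  refine Matrix.inv_eq_right_inv ?_
  rw [← Matrix.map_mul, Matrix.mul_nonsing_inv G hG]
  simp

instance [Nonempty U] : Nontrivial (SmoothFun U) :=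
  (eval (Classical.arbitrary U)).toRingHom.domain_nontrivial

end SmoothFun
end AlmostCoKahler

/-! ### Charts, coordinate frames and local representatives. -/

namespace AlmostCoKahler

variable {d : ℕ} {M : Type*} [TopologicalSpace M] [ChartedSpace (EuclideanSpace ℝ (Fin d)) M]

namespace SmoothCharts

variable {e : OpenPartialHomeomorph M (EuclideanSpace ℝ (Fin d))}

theorem mdifferentiable [IsManifold (𝓡 d) ∞ M] (he : e ∈ SmoothCharts d M) :
    e.MDifferentiable (𝓡 d) (𝓡 d) :=
  ⟨(contMDiffOn_of_mem_maximalAtlas he).mdifferentiableOn (by simp),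
    (contMDiffOn_symm_of_mem_maximalAtlas he).mdifferentiableOn (by simp)⟩

/-- This form of the frame, through the derivative of `e.symm`, exhibits its smooth dependence on p
and lets the chain rule apply. -/
theorem frame_eq [IsManifold (𝓡 d) ∞ M] (he : e ∈ SmoothCharts d M) {p : M} (hp : p ∈ e.source)
    (i : Fin d) :
    frame e p i = mfderiv (𝓡 d) (𝓡 d) e.symm (e p) (EuclideanSpace.single i (1 : ℝ)) := by
  have h : mvfderiv (𝓡 d) e p = (((mdifferentiable he).mfderiv hp :
      TangentSpace (𝓡 d) p ≃L[ℝ] TangentSpace (𝓡 d) (e p)).trans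
      (NormedSpace.fromTangentSpace (e p)) : TangentSpace (𝓡 d) p →L[ℝ] _) := rfl
  rw [frame, h, ContinuousLinearMap.inverse_equiv]
  rfl

theorem coord_frame [IsManifold (𝓡 d) ∞ M] (he : e ∈ SmoothCharts d M) {p : M} (hp : p ∈ e.source)
    (i j : Fin d) : coord e p (frame e p i) j = if i = j then 1 else 0 := by
  have h : mvfderiv (𝓡 d) e p = (((mdifferentiable he).mfderiv hp :
      TangentSpace (𝓡 d) p ≃L[ℝ] TangentSpace (𝓡 d) (e p)).trans
      (NormedSpace.fromTangentSpace (e p)) : TangentSpace (𝓡 d) p →L[ℝ] _) := rfl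
  rw [coord, frame, h, ContinuousLinearMap.inverse_equiv]
  simp [eq_comm]

theorem sum_coord [IsManifold (𝓡 d) ∞ M] (he : e ∈ SmoothCharts d M) {p : M} (hp : p ∈ e.source)
    (X : TangentSpace (𝓡 d) p) : X = ∑ i, coord e p X i • frame e p i := by
  obtain ⟨h, hh⟩ : ∃ h : TangentSpace (𝓡 d) p ≃L[ℝ] EuclideanSpace ℝ (Fin d),
      mvfderiv (𝓡 d) e p = h :=
    ⟨((mdifferentiable he).mfderiv hp :
      TangentSpace (𝓡 d) p ≃L[ℝ] TangentSpace (𝓡 d) (e p)).trans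
      (NormedSpace.fromTangentSpace (e p)), rfl⟩
  apply h.injective
  ext j
  simp only [coord, frame, hh, ContinuousLinearMap.inverse_equiv]
  simp [Pi.single_apply]

theorem coord_sum [IsManifold (𝓡 d) ∞ M] (he : e ∈ SmoothCharts d M) {p : M} (hp : p ∈ e.source)
    (v : Fin d → ℝ) (j : Fin d) : coord e p (∑ i, v i • frame e p i) j = v j := by
  have h := coord_frame he hp (j := j)
  simp only [coord] at h ⊢
  simp [h]

theorem contMDiffOn_frame [IsManifold (𝓡 d) ∞ M] (he : e ∈ SmoothCharts d M) (i : Fin d) :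
    ContMDiffOn (𝓡 d) ((𝓡 d).prod (𝓡 d)) ∞ (fun p => Bundle.TotalSpace.mk'
      (EuclideanSpace ℝ (Fin d)) (E := fun p : M => TangentSpace (𝓡 d) p) p (frame e p i))
      e.source := by
  have : IsManifold (𝓡 d) 1 M := IsManifold.of_le (n := ∞) (by simp)
  have h1 := (contMDiffOn_symm_of_mem_maximalAtlas he).contMDiffOn_tangentMapWithin (m := ∞)
    (by simp) e.open_target.uniqueMDiffOn
  have h2 : ContMDiff (𝓡 d) ((𝓡 d).prod (𝓡 d)) ∞ (fun y : EuclideanSpace ℝ (Fin d) =>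
      (Bundle.TotalSpace.mk y (EuclideanSpace.single i (1 : ℝ)) :
        TangentBundle (𝓡 d) (EuclideanSpace ℝ (Fin d)))) :=
    fun y => contMDiffAt_vectorSpace_iff_contDiffAt.2 contDiffAt_const
  have h3 := (h1.comp (h2.contMDiffOn (s := e.target)) (fun y hy => hy)).comp
    (contMDiffOn_of_mem_maximalAtlas he) (fun p hp => e.map_source hp)
  refine h3.congr fun p hp => ?_
  rw [frame_eq he hp]
  have h4 : e.symm (e p) = p := e.left_inv hp
  simp only [Function.comp, tangentMapWithin]
  rw [mfderivWithin_of_isOpen e.open_target (e.map_source hp)]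
  exact Bundle.TotalSpace.ext h4.symm HEq.rfl

theorem mvfderiv_frame [IsManifold (𝓡 d) ∞ M] (he : e ∈ SmoothCharts d M) {p : M}
    (hp : p ∈ e.source) {f : M → ℝ} (hf : ContMDiff (𝓡 d) 𝓘(ℝ, ℝ) ∞ f) (i : Fin d) :
    mvfderiv (𝓡 d) f p (frame e p i) = partialDeriv e i f p := by
  have h1 : MDifferentiableAt (𝓡 d) 𝓘(ℝ, ℝ) f (e.symm (e p)) :=
    hf.mdifferentiableAt (by simp)
  have h2 := (mdifferentiable he).mdifferentiableAt_symm (e.map_source hp)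
  have h3 := mfderiv_comp (e p) h1 h2
  rw [frame_eq he hp, partialDeriv, ← mfderiv_eq_fderiv]
  change _ = mfderiv (𝓡 d) 𝓘(ℝ, ℝ) (f ∘ e.symm) (e p) _
  rw [h3, e.left_inv hp]
  rfl

theorem contDiffOn_comp_symm [IsManifold (𝓡 d) ∞ M] (he : e ∈ SmoothCharts d M) {F : M → ℝ}
    (hF : ContMDiffOn (𝓡 d) 𝓘(ℝ, ℝ) ∞ F e.source) :
    ContDiffOn ℝ ∞ (fun y => F (e.symm y)) e.target :=
  (hF.comp (contMDiffOn_symm_of_mem_maximalAtlas he) fun _ hy => e.map_target hy).contDiffOn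

end SmoothCharts

/-- The image of a chart. -/
def chartImage (e : OpenPartialHomeomorph M (EuclideanSpace ℝ (Fin d))) :
    TopologicalSpace.Opens (EuclideanSpace ℝ (Fin d)) := ⟨e.target, e.open_target⟩

/-- The function `F` is represented by `r` in the chart `e`. -/
def Rep (e : OpenPartialHomeomorph M (EuclideanSpace ℝ (Fin d))) (F : M → ℝ)
    (r : SmoothFun (chartImage e)) : Prop :=
  ∀ y : chartImage e, F (e.symm y) = SmoothFun.eval y r

namespace Rep

variable {e : OpenPartialHomeomorph M (EuclideanSpace ℝ (Fin d))}

theorem exists_rep [IsManifold (𝓡 d) ∞ M] (he : e ∈ SmoothCharts d M) {F : M → ℝ}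
    (hF : ContMDiffOn (𝓡 d) 𝓘(ℝ, ℝ) ∞ F e.source) : ∃ r, Rep e F r :=
  ⟨SmoothFun.mk _ (SmoothCharts.contDiffOn_comp_symm he hF), fun _ => rfl⟩

omit [ChartedSpace (EuclideanSpace ℝ (Fin d)) M] in
theorem partialDeriv {F : M → ℝ} {r : SmoothFun (chartImage e)} (h : Rep e F r) (i : Fin d) :
    Rep e (partialDeriv e i F) ((SmoothFun.coordSystem (chartImage e)).pd i r) := by
  intro y
  rw [AlmostCoKahler.partialDeriv, e.right_inv y.2]
  exact (SmoothFun.pd_apply i r (fun y => F (e.symm y)) h y).symm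

end Rep

section Metric

variable [IsManifold (𝓡 d) ∞ M] {e : OpenPartialHomeomorph M (EuclideanSpace ℝ (Fin d))}
  {g : RiemMetric d M}

theorem contMDiffOn_inner {s : Set M} {X Y : ∀ p : M, TangentSpace (𝓡 d) p}
    (hX : ContMDiffOn (𝓡 d) ((𝓡 d).prod (𝓡 d)) ∞ (fun p => Bundle.TotalSpace.mk'
      (EuclideanSpace ℝ (Fin d)) (E := fun p : M => TangentSpace (𝓡 d) p) p (X p)) s)
    (hY : ContMDiffOn (𝓡 d) ((𝓡 d).prod (𝓡 d)) ∞ (fun p => Bundle.TotalSpace.mk'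
      (EuclideanSpace ℝ (Fin d)) (E := fun p : M => TangentSpace (𝓡 d) p) p (Y p)) s) :
    ContMDiffOn (𝓡 d) 𝓘(ℝ, ℝ) ∞ (fun p => g.inner p (X p) (Y p)) s := by
  intro x hx
  have : ContMDiffWithinAt (𝓡 d) ((𝓡 d).prod 𝓘(ℝ)) ∞ (fun m ↦ Bundle.TotalSpace.mk' ℝ
      (E := Bundle.Trivial M ℝ) m (g.inner m (X m) (Y m))) s x := by
    apply ContMDiffWithinAt.clm_bundle_apply₂ (F₁ := EuclideanSpace ℝ (Fin d))
      (F₂ := EuclideanSpace ℝ (Fin d))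
    · exact g.contMDiff.contMDiffAt.contMDiffWithinAt
    · exact hX x hx
    · exact hY x hx
  simp only [Bundle.contMDiffWithinAt_totalSpace] at this
  exact this.2

/-- A kernel vector would be the coordinate vector of a nonzero tangent vector of zero length. -/
theorem metricMatrix_det_ne_zero (he : e ∈ SmoothCharts d M) {p : M} (hp : p ∈ e.source) :
    (metricMatrix g e p).det ≠ 0 := by
  intro h
  obtain ⟨v, hv, hv0⟩ := Matrix.exists_mulVec_eq_zero_iff.2 h
  have h1 : g.inner p (∑ i, v i • frame e p i) (∑ i, v i • frame e p i) = 0 := by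
    have : g.inner p (∑ i, v i • frame e p i) (∑ i, v i • frame e p i)
        = v ⬝ᵥ (metricMatrix g e p).mulVec v := by
      simp [metricMatrix, Matrix.mulVec, dotProduct, Finset.mul_sum]
      exact Finset.sum_congr rfl fun i _ => Finset.sum_congr rfl fun j _ => by
        rw [g.symm p (frame e p j)]; ring
    rw [this, hv0]; simp
  have h2 : ∑ i, v i • frame e p i = 0 := by
    by_contra h2
    exact (g.pos p _ h2).ne' h1
  apply hv
  ext j
  have h3 := congrArg (fun X => coord e p X j) h2
  rw [SmoothCharts.coord_sum he hp] at h3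
  simpa [coord] using h3

end Metric
end AlmostCoKahler

/-! ### Dictionary between tensors in a chart and the algebraic calculus. -/

namespace AlmostCoKahler

variable {d : ℕ} {M : Type*} [TopologicalSpace M] [ChartedSpace (EuclideanSpace ℝ (Fin d)) M]
  [IsManifold (𝓡 d) ∞ M]

/-- The components of a metric in a chart, as elements of the ring of smooth functions. -/
structure ChartMetric (g : RiemMetric d M)
    (e : OpenPartialHomeomorph M (EuclideanSpace ℝ (Fin d))) where
  mem : e ∈ SmoothCharts d M
  /-- the metric matrix -/
  G : Matrix (Fin d) (Fin d) (SmoothFun (chartImage e))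
  rep : ∀ i j, Rep e (fun q => metricMatrix g e q i j) (G i j)

namespace ChartMetric

variable {g : RiemMetric d M} {e : OpenPartialHomeomorph M (EuclideanSpace ℝ (Fin d))}

theorem exists_chartMetric (g : RiemMetric d M) (he : e ∈ SmoothCharts d M) :
    Nonempty (ChartMetric g e) := by
  have h (i j : Fin d) : ∃ r, Rep e (fun q => metricMatrix g e q i j) r :=
    Rep.exists_rep he (contMDiffOn_inner (SmoothCharts.contMDiffOn_frame he i)
      (SmoothCharts.contMDiffOn_frame he j))
  choose G hG using h
  exact ⟨he, G, hG⟩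

variable (N : ChartMetric g e)

omit [ChartedSpace (EuclideanSpace ℝ (Fin d)) M] [IsManifold (𝓡 d) ∞ M] in
theorem mem_source (y : chartImage e) : e.symm y ∈ e.source := e.map_target y.2

theorem G_symm (i j : Fin d) : N.G i j = N.G j i :=
  SmoothFun.ext_eval fun y => by
    rw [← N.rep i j y, ← N.rep j i y]; exact g.symm _ _ _

theorem map_G (y : chartImage e) : N.G.map (SmoothFun.eval y) = metricMatrix g e (e.symm y) := by
  ext i j; exact (N.rep i j y).symm

theorem isUnit_det : IsUnit N.G.det :=
  SmoothFun.isUnit_of_eval_ne_zero _ fun y => by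
    rw [AlgHom.map_det, AlgHom.mapMatrix_apply, N.map_G]
    exact metricMatrix_det_ne_zero N.mem (mem_source y)

theorem eval_G_inv (y : chartImage e) (i j : Fin d) :
    SmoothFun.eval y (N.G⁻¹ i j) = (metricMatrix g e (e.symm y))⁻¹ i j := by
  rw [← N.map_G, SmoothFun.eval_inv N.isUnit_det]; rfl

/-- The coordinate system of the chart. -/
noncomputable abbrev P (_ : ChartMetric g e) : CoordSystem (Fin d) (SmoothFun (chartImage e)) :=
  SmoothFun.coordSystem (chartImage e)

/-- The Levi-Civita calculus of the chart. -/
noncomputable abbrev cal : LeviCivitaCalculus (SmoothFun (chartImage e))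
    (Fin d → SmoothFun (chartImage e)) :=
  N.P.calculus N.G N.G_symm N.isUnit_det

theorem rep_chr (k i j : Fin d) : Rep e (christoffel g e k i j) (N.P.chr N.G k i j) := fun y => by
  simp only [christoffel, CoordSystem.chr, map_mul, map_sum, map_add, map_sub, N.eval_G_inv,
    ← (N.rep _ _).partialDeriv _ y, AlgHom.commutes]
  rfl

theorem rep_curvature (l i j k : Fin d) : Rep e (curvatureCoeff g e l i j k)
    (N.P.pd i (N.P.chr N.G l j k) - N.P.pd j (N.P.chr N.G l i k)
        + ∑ s, (N.P.chr N.G l i s * N.P.chr N.G s j k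
          - N.P.chr N.G l j s * N.P.chr N.G s i k)) := fun y => by
  simp only [curvatureCoeff, map_mul, map_sum, map_add, map_sub, ← N.rep_chr _ _ _ y,
    ← (N.rep_chr _ _ _).partialDeriv _ y]

/-- The tangent vector at a point of the chart given by a vector field in coordinates. -/
noncomputable def vec (_ : ChartMetric g e) (y : chartImage e)
    (X : Fin d → SmoothFun (chartImage e)) : TangentSpace (𝓡 d) (e.symm y) :=
  ∑ i, SmoothFun.eval y (X i) • frame e (e.symm y) i

theorem coord_vec (y : chartImage e) (X : Fin d → SmoothFun (chartImage e)) (i : Fin d) :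
    coord e (e.symm y) (N.vec y X) i = SmoothFun.eval y (X i) :=
  SmoothCharts.coord_sum N.mem (mem_source y) _ i

theorem vec_injective {X Y : Fin d → SmoothFun (chartImage e)} (h : ∀ y, N.vec y X = N.vec y Y) :
    X = Y := by
  ext1 i
  refine SmoothFun.ext_eval fun y => ?_
  rw [← N.coord_vec, h, N.coord_vec]

theorem vec_add (y : chartImage e) (X Y : Fin d → SmoothFun (chartImage e)) :
    N.vec y (X + Y) = N.vec y X + N.vec y Y := by
  simp [vec, add_smul, Finset.sum_add_distrib]

theorem vec_smul (y : chartImage e) (f : SmoothFun (chartImage e))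
    (X : Fin d → SmoothFun (chartImage e)) :
    N.vec y (f • X) = SmoothFun.eval y f • N.vec y X := by
  simp [vec, mul_smul, Finset.smul_sum]

theorem vec_neg (y : chartImage e) (X : Fin d → SmoothFun (chartImage e)) :
    N.vec y (-X) = -N.vec y X := by
  simp [vec]

theorem vec_sub (y : chartImage e) (X Y : Fin d → SmoothFun (chartImage e)) :
    N.vec y (X - Y) = N.vec y X - N.vec y Y := by
  rw [sub_eq_add_neg, vec_add, vec_neg, sub_eq_add_neg]

theorem vec_single (y : chartImage e) (i : Fin d) :
    N.vec y (Pi.single i 1) = frame e (e.symm y) i := by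
  rw [vec, Finset.sum_eq_single i]
  · simp
  · intro j _ hj; simp [hj]
  · simp

theorem eval_form (y : chartImage e) (X Y : Fin d → SmoothFun (chartImage e)) :
    SmoothFun.eval y (N.cal.g X Y) = g.inner (e.symm y) (N.vec y X) (N.vec y Y) := by
  change SmoothFun.eval y (CoordSystem.form N.G X Y) = _
  rw [CoordSystem.form_apply, vec, vec]
  simp only [map_sum, map_mul, map_smul, _root_.sum_apply,
    _root_.smul_apply, ← N.rep _ _ y, metricMatrix, Matrix.of_apply, smul_eq_mul,
    Finset.mul_sum]
  rw [Finset.sum_comm]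
  exact Finset.sum_congr rfl fun _ _ => Finset.sum_congr rfl fun _ _ => by ring

theorem vec_K (y : chartImage e) (X Y Z : Fin d → SmoothFun (chartImage e)) :
    N.vec y (N.cal.K X Y Z)
      = curvature g e (e.symm y) (N.vec y X) (N.vec y Y) (N.vec y Z) := by
  rw [vec, curvature]
  refine Finset.sum_congr rfl fun l _ => ?_
  rw [N.P.K_apply]
  simp only [map_sum, map_mul, N.coord_vec, ← N.rep_curvature l _ _ _ y, mul_assoc]

theorem eval_ricci (y : chartImage e) (Y Z : Fin d → SmoothFun (chartImage e)) :
    SmoothFun.eval y (LinearMap.trace (SmoothFun (chartImage e)) _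
      ((N.cal.curv.flip Y).flip Z)) = ricci g e (e.symm y) (N.vec y Y) (N.vec y Z) := by
  rw [N.P.trace_curv, map_sum, ricci]
  refine Finset.sum_congr rfl fun i _ => ?_
  rw [← N.coord_vec, N.vec_K, N.vec_single]

theorem rep_dir {f : M → ℝ} {r : SmoothFun (chartImage e)} (hr : Rep e f r)
    (hf : ContMDiff (𝓡 d) 𝓘(ℝ, ℝ) ∞ f) (y : chartImage e)
    (X : Fin d → SmoothFun (chartImage e)) :
    SmoothFun.eval y (N.cal.D X r) = mvfderiv (𝓡 d) f (e.symm y) (N.vec y X) := by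
  change SmoothFun.eval y (N.P.dir X r) = _
  rw [CoordSystem.dir_apply, vec]
  simp only [map_sum, map_mul, map_smul, SmoothCharts.mvfderiv_frame N.mem (mem_source y) hf,
    ← hr.partialDeriv _ y, smul_eq_mul]

theorem eval_hessian {f : M → ℝ} {r : SmoothFun (chartImage e)} (hr : Rep e f r)
    (y : chartImage e) (X Y : Fin d → SmoothFun (chartImage e)) :
    SmoothFun.eval y (N.cal.D X (N.cal.D Y r) - N.cal.D (N.cal.nabla X Y) r)
      = hessian g e f (e.symm y) (N.vec y X) (N.vec y Y) := by
  change SmoothFun.eval y (N.P.dir X (N.P.dir Y r) - N.P.dir (N.P.nabla N.G X Y) r) = _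
  rw [CoordSystem.hessian_eq, hessian]
  simp only [map_sum, map_mul, map_sub, N.coord_vec, ← hr.partialDeriv _ y,
    ← (hr.partialDeriv _).partialDeriv _ y, ← N.rep_chr _ _ _ y]

/-- Coordinates from the metric. -/
theorem coord_eq (N : ChartMetric g e) (y : chartImage e) (X : TangentSpace (𝓡 d) (e.symm y)) (k : Fin d) :
    coord e (e.symm y) X k = ∑ l, (metricMatrix g e (e.symm y))⁻¹ k l
      * g.inner (e.symm y) X (frame e (e.symm y) l) := by
  have h : (fun l => g.inner (e.symm y) X (frame e (e.symm y) l))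
      = (metricMatrix g e (e.symm y)).mulVec (coord e (e.symm y) X) := by
    ext l
    conv_lhs => rw [SmoothCharts.sum_coord N.mem (mem_source y) X]
    simp only [map_sum, map_smul, _root_.sum_apply, _root_.smul_apply,
      Matrix.mulVec, dotProduct, metricMatrix, Matrix.of_apply, smul_eq_mul]
    exact Finset.sum_congr rfl fun i _ => by rw [g.symm]; ring
  have h1 := congrArg (fun v => (metricMatrix g e (e.symm y))⁻¹.mulVec v k) h
  simp only [Matrix.mulVec_mulVec] at h1
  rw [Matrix.nonsing_inv_mul _ (metricMatrix_det_ne_zero N.mem (mem_source y)).isUnit,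
    Matrix.one_mulVec] at h1
  exact h1.symm

/-- Smoothness of the components follows from Xᵏ = ∑ gᵏˡ g(X, ∂_l), a combination of smooth inner
products. -/
theorem exists_vec {X : ∀ p : M, TangentSpace (𝓡 d) p}
    (hX : ContMDiffOn (𝓡 d) ((𝓡 d).prod (𝓡 d)) ∞ (fun p => Bundle.TotalSpace.mk'
      (EuclideanSpace ℝ (Fin d)) (E := fun p : M => TangentSpace (𝓡 d) p) p (X p)) e.source) :
    ∃ Z, ∀ y, N.vec y Z = X (e.symm y) := by
  have h (l : Fin d) : ∃ r, Rep e (fun q => g.inner q (X q) (frame e q l)) r :=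
    Rep.exists_rep N.mem (contMDiffOn_inner hX (SmoothCharts.contMDiffOn_frame N.mem l))
  choose w hw using h
  refine ⟨fun k => ∑ l, N.G⁻¹ k l * w l, fun y => ?_⟩
  conv_rhs => rw [SmoothCharts.sum_coord N.mem (mem_source y) (X (e.symm y))]
  rw [vec]
  refine Finset.sum_congr rfl fun k _ => ?_
  rw [N.coord_eq]
  simp only [map_sum, map_mul, N.eval_G_inv, ← hw _ y]

end ChartMetric
end AlmostCoKahler

/-! ### Transfer of the almost co-Kähler structure to a chart, and the conclusion. -/

namespace AlmostCoKahler

variable {n : ℕ} {M : Type*} [TopologicalSpace M]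
  [ChartedSpace (EuclideanSpace ℝ (Fin (2 * n + 1))) M] [IsManifold (𝓡 (2 * n + 1)) ∞ M]

namespace AlmostContactMetric

variable (S : AlmostContactMetric n M)

/-- The axioms give φ²ζ = 0, hence φζ = cζ with c = η(φζ), and then cφζ = φ(cζ) = φ²ζ = 0; so c = 0
or φζ = 0. -/
theorem φ_ζ (p : M) : S.φ p (S.ζ p) = 0 := by
  have h1 : S.φ p (S.φ p (S.ζ p)) = 0 := by
    have := S.φ_sq p (S.ζ p)
    rw [S.η_ζ, one_smul] at this
    simpa using this
  have h2 : S.φ p (S.ζ p) = S.η p (S.φ p (S.ζ p)) • S.ζ p := by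
    have := S.φ_sq p (S.φ p (S.ζ p))
    rwa [h1, map_zero, zero_add] at this
  have h3 : S.η p (S.φ p (S.ζ p)) • S.φ p (S.ζ p) = 0 := by
    rw [← map_smul, ← h2, h1]
  rcases smul_eq_zero.1 h3 with h | h
  · rw [h2, h, zero_smul]
  · exact h

theorem inner_ζ (p : M) (X : TangentSpace (𝓡 (2 * n + 1)) p) :
    S.g.inner p X (S.ζ p) = S.η p X := by
  rw [S.compatible, S.φ_ζ, S.η_ζ]; simp

theorem η_φ (p : M) (X : TangentSpace (𝓡 (2 * n + 1)) p) : S.η p (S.φ p X) = 0 := by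
  rw [← S.inner_ζ, S.compatible, S.φ_ζ, S.η_ζ, ← S.inner_ζ]
  have h1 := S.φ_sq p (S.φ p X)
  have h2 := congrArg (S.φ p) (S.φ_sq p X)
  rw [map_add, map_smul, S.φ_ζ, smul_zero] at h2
  rw [h2] at h1
  have h3 := congrArg (S.η p) h1.symm
  rw [map_smul, S.η_ζ, map_zero] at h3
  rw [S.inner_ζ]
  simpa using h3

theorem inner_φ (p : M) (X Y : TangentSpace (𝓡 (2 * n + 1)) p) :
    S.g.inner p (S.φ p X) Y = -S.g.inner p X (S.φ p Y) := by
  have h := S.compatible p X (S.φ p Y)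
  rw [eq_sub_of_add_eq (S.φ_sq p Y), S.η_φ, map_sub, map_smul, S.inner_ζ, S.η_φ] at h
  rw [h]; simp

end AlmostContactMetric

namespace ChartMetric

section

variable {d : ℕ} {M : Type*} [TopologicalSpace M] [ChartedSpace (EuclideanSpace ℝ (Fin d)) M]
  [IsManifold (𝓡 d) ∞ M] {g : RiemMetric d M}
  {e : OpenPartialHomeomorph M (EuclideanSpace ℝ (Fin d))} (N : ChartMetric g e)

theorem closed_of_isClosedOneForm {α : ∀ p : M, TangentSpace (𝓡 d) p → ℝ}
    (hα : IsClosedOneForm α) {Z : Fin d → SmoothFun (chartImage e)}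
    (h : ∀ y X, SmoothFun.eval y (N.cal.g Z X) = α (e.symm y) (N.vec y X))
    [Nonempty (Fin d)] (X Y : Fin d → SmoothFun (chartImage e)) :
    N.cal.g (N.cal.nabla X Z) Y = N.cal.g (N.cal.nabla Y Z) X := by
  have hr (j) : Rep e (fun q => α q (frame e q j)) (N.cal.g Z (Pi.single j 1)) := fun y => by
    rw [h, N.vec_single]
  refine N.P.closed_one_form N.G_symm N.isUnit_det (fun i j => SmoothFun.ext_eval fun y => ?_) X Y
  exact ((hr j).partialDeriv i y).symm.trans
    ((hα e N.mem _ (mem_source y) i j).trans ((hr i).partialDeriv j y))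

theorem closed_of_isClosedTwoForm
    {β : ∀ p : M, TangentSpace (𝓡 d) p → TangentSpace (𝓡 d) p → ℝ} (hβ : IsClosedTwoForm β)
    {F : (Fin d → SmoothFun (chartImage e)) →ₗ[SmoothFun (chartImage e)]
      (Fin d → SmoothFun (chartImage e))}
    (skew : ∀ X Y, N.cal.g (F X) Y = -N.cal.g X (F Y))
    (h : ∀ y X Y, SmoothFun.eval y (N.cal.g X (F Y)) = β (e.symm y) (N.vec y X) (N.vec y Y))
    [Nonempty (Fin d)] (X Y Z : Fin d → SmoothFun (chartImage e)) :
    N.cal.g (N.cal.nabla X (F Y) - F (N.cal.nabla X Y)) Z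
      + N.cal.g (N.cal.nabla Y (F Z) - F (N.cal.nabla Y Z)) X
      + N.cal.g (N.cal.nabla Z (F X) - F (N.cal.nabla Z X)) Y = 0 := by
  have hr (j k) : Rep e (fun q => β q (frame e q j) (frame e q k))
      (N.cal.g (Pi.single j 1) (F (Pi.single k 1))) := fun y => by
    rw [h, N.vec_single, N.vec_single]
  refine N.P.closed_two_form N.G_symm N.isUnit_det skew
    (fun i j k => SmoothFun.ext_eval fun y => ?_) X Y Z
  have h1 := hβ e N.mem _ (mem_source y) i j k
  have e1 := (hr j k).partialDeriv i y
  have e2 := (hr k i).partialDeriv j y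
  have e3 := (hr i j).partialDeriv k y
  rw [e1, e2, e3, ← map_add, ← map_add] at h1
  exact h1.trans (map_zero _).symm

theorem K_of_mem_nullityDistribution {κ : ℝ} {Z : Fin d → SmoothFun (chartImage e)}
    (h : ∀ y : chartImage e, N.vec y Z ∈ nullityDistribution g κ (e.symm y))
    (X Y : Fin d → SmoothFun (chartImage e)) :
    N.cal.K X Y Z = algebraMap ℝ (SmoothFun (chartImage e)) κ
      • (N.cal.g Y Z • X - N.cal.g X Z • Y) := N.vec_injective fun y => by
  rw [N.vec_K, N.vec_smul, N.vec_sub, N.vec_smul, N.vec_smul, N.eval_form, N.eval_form,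
    AlgHom.commutes]
  exact h y e N.mem (mem_source y) _ _

theorem eval_quasiEinstein {m : ℝ≥0∞} {ρ lam : ℝ} {f : M → ℝ}
    (hf : IsQuasiEinstein g m ρ lam f) {r : SmoothFun (chartImage e)} (hr : Rep e f r)
    (y : chartImage e) (X Y : Fin d → SmoothFun (chartImage e)) :
    SmoothFun.eval y (LinearMap.trace (SmoothFun (chartImage e))
        (Fin d → SmoothFun (chartImage e)) ((N.cal.curv.flip X).flip Y))
      + SmoothFun.eval y (N.cal.D X (N.cal.D Y r) - N.cal.D (N.cal.nabla X Y) r)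
      - (m⁻¹).toReal * (SmoothFun.eval y (N.cal.D X r) * SmoothFun.eval y (N.cal.D Y r))
      = (ρ * scalarCurvature g e (e.symm y) + lam) * SmoothFun.eval y (N.cal.g X Y) :=
  (congrArg₂ (· - ·) (congrArg₂ (· + ·) (N.eval_ricci y X Y) (N.eval_hessian hr y X Y))
    (congrArg ((m⁻¹).toReal * ·) (congrArg₂ (· * ·) (N.rep_dir hr hf.smooth y X)
      (N.rep_dir hr hf.smooth y Y)))).trans
    ((hf.eqn e N.mem _ (mem_source y) (N.vec y X) (N.vec y Y)).trans
      (congrArg (_ * ·) (N.eval_form y X Y).symm))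

end


variable {S : AlmostContactMetric n M}
  {e : OpenPartialHomeomorph M (EuclideanSpace ℝ (Fin (2 * n + 1)))} (N : ChartMetric S.g e)

theorem exists_ζ : ∃ Z, ∀ y, N.vec y Z = S.ζ (e.symm y) := N.exists_vec S.smooth_ζ.contMDiffOn

theorem exists_φ : ∃ F : (Fin (2 * n + 1) → SmoothFun (chartImage e))
    →ₗ[SmoothFun (chartImage e)] (Fin (2 * n + 1) → SmoothFun (chartImage e)),
    ∀ y X, N.vec y (F X) = S.φ (e.symm y) (N.vec y X) := by
  have h (i : Fin (2 * n + 1)) := N.exists_vec (X := fun p => S.φ p (frame e p i))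
    (S.smooth_φ.contMDiffOn.clm_bundle_apply (SmoothCharts.contMDiffOn_frame N.mem i))
  choose W hW using h
  refine ⟨Fintype.linearCombination _ W, fun y X => ?_⟩
  induction X using CoordSystem.induction_single with
  | add X Y hX hY => rw [map_add, N.vec_add, N.vec_add, hX, hY, map_add]
  | smul f X hX => rw [map_smul, N.vec_smul, N.vec_smul, hX, map_smul]
  | single i => simp [hW, N.vec_single]

set_option maxHeartbeats 1000000 in
theorem exists_nullity (hS : S.IsAlmostCoKahler) {κ : ℝ}
    (hζ : ∀ p : M, S.ζ p ∈ nullityDistribution S.g κ p) : Nonempty (N.cal.Nullity κ) := by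
  obtain ⟨Z, hZ⟩ := N.exists_ζ
  obtain ⟨F, hF⟩ := N.exists_φ
  have skew (X Y) : N.cal.g (F X) Y = -N.cal.g X (F Y) := SmoothFun.ext_eval fun y => by
    rw [map_neg, N.eval_form, N.eval_form, hF, hF, S.inner_φ]
  have eη (y X) : SmoothFun.eval y (N.cal.g Z X) = S.η (e.symm y) (N.vec y X) := by
    rw [N.eval_form, hZ, S.g.symm, S.inner_ζ]
  have eΦ (y X Y) : SmoothFun.eval y (N.cal.g X (F Y))
      = S.g.inner (e.symm y) (N.vec y X) (S.φ (e.symm y) (N.vec y Y)) := by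
    rw [N.eval_form, hF]
  have hZ' (y : chartImage e) : N.vec y Z ∈ nullityDistribution S.g κ (e.symm y) := by
    rw [hZ]; exact hζ _
  have h1 := N.closed_of_isClosedOneForm hS.closed_η eη
  have h2 := N.closed_of_isClosedTwoForm hS.closed_Φ skew eΦ
  have h3 := N.K_of_mem_nullityDistribution hZ'
  have h4 (X) : F (F X) = -X + N.cal.g X Z • Z := N.vec_injective fun y => by
    have h := S.φ_sq (e.symm y) (N.vec y X)
    rw [← hF, ← hF, ← eη, ← hZ, N.cal.g_symm, ← N.vec_smul] at h
    rw [N.vec_add, N.vec_neg, ← h]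
    abel
  have h5 : F Z = 0 := N.vec_injective fun y => by
    rw [hF, hZ, S.φ_ζ]; simp [vec]
  have h6 : N.cal.g Z Z = 1 := SmoothFun.ext_eval fun y => by
    rw [eη, hZ, S.η_ζ, map_one]
  exact ⟨LeviCivitaCalculus.Nullity.mk (C := N.cal) F Z h4 h5 h6 skew h1 h2 h3⟩

end ChartMetric

end AlmostCoKahler

theorem mainTheorem6 (n : ℕ) (hn : 1 ≤ n) {M : Type*} [TopologicalSpace M] [T2Space M]
    [SecondCountableTopology M] [Nonempty M]
    [ChartedSpace (EuclideanSpace ℝ (Fin (2 * n + 1))) M] [IsManifold (𝓡 (2 * n + 1)) ∞ M]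
    (S : AlmostCoKahler.AlmostContactMetric n M) (hS : S.IsAlmostCoKahler)
    (κ : ℝ) (hκ : κ < 0)
    (hζ : ∀ p : M, S.ζ p ∈ AlmostCoKahler.nullityDistribution S.g κ p) :
    ¬ ∃ (m : ℝ≥0∞) (ρ lam : ℝ) (f : M → ℝ),
      m ≠ 1 ∧ AlmostCoKahler.IsQuasiEinstein S.g m ρ lam f := by
  open AlmostCoKahler in
  rintro ⟨m, ρ, lam, f, -, hf⟩
  obtain ⟨p⟩ := ‹Nonempty M›
  obtain ⟨e, he, hpe⟩ : ∃ e ∈ SmoothCharts (2 * n + 1) M, p ∈ e.source :=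
    ⟨_, IsManifold.chart_mem_maximalAtlas p, mem_chart_source _ p⟩
  -- The contradiction is local, so one chart suffices; a nonempty image makes its ring of functions
  -- nontrivial.
  have : Nonempty (chartImage e) := ⟨⟨e p, e.map_source hpe⟩⟩
  obtain ⟨N⟩ := ChartMetric.exists_chartMetric S.g he
  obtain ⟨Q⟩ := N.exists_nullity hS hζ
  obtain ⟨r, hr⟩ := Rep.exists_rep he hf.smooth.contMDiffOn
  refine Q.not_quasiEinstein_of_eval hκ.ne SmoothFun.eval (fun _ _ => SmoothFun.ext_eval) _ _ r ?_
    (N.eval_quasiEinstein hf hr)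
  rw [Module.finrank_fin_fun]; omega
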